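/- Let $\mathbb F$ be an arbitrary field, let $n,\ell\ge 1$ and $d\ge 0$ be integers, and put $k=(2d+1)\ell$. Let $P(\lambda)=\sum_{j=0}^k\lambda^jP_j\in\mathbb F[\lambda]^{n\times n}$ be a matrix polynomial of grade $k$ (that is, of degree at most $k$), not required to have any symmetry structure, and let $M(\lambda)=\sum_{i=0}^{\ell}\lambda^iM_i\in\mathbb F[\lambda]^{(d+1)n\times(d+1)n}$ be a matrix polynomial of grade $\ell$. Partition each $M_i$ into $(d+1)\times(d+1)$ blocks $[M_i]_{s,t}\in\mathbb F^{n\times n}$, $1\le s,t\le d+1$. All sums below run over the pairs $(s,t)$ with $1\le s,t\le d+1$ satisfying the indicated relation, and an empty sum is $0$. We say that $M$ satisfies, for $P$, - condition (AS) if $P_{\ell r}=\sum_{s+t=2d+2-r}[M_0]_{s,t}+\sum_{s+t=2d+3-r}[M_\ell]_{s,t}$ for $0\le r\le 2d+1$, and $P_{\ell r+c}=\sum_{s+t=2d+2-r}[M_c]_{s,t}$ for $0\le r\le 2d$, $1\le c\le \ell-1$; - condition (ASS) if the same identities hold with every block $[M_i]_{s,t}$ multiplied by $(-1)^{d-s+1}$;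 - condition (DS) if $P_{\ell r}=\sum_{s-t=r-d}[M_0]_{s,t}+\sum_{s-t=r-d-1}[M_\ell]_{s,t}$ for $0\le r\le 2d+1$, and $P_{\ell r+c}=\sum_{s-t=r-d}[M_c]_{s,t}$ for $0\le r\le 2d$, $1\le c\le\ell-1$. Let $A_1=\begin{bmatrix}1&0\\0&1\end{bmatrix}$, $A_2=\begin{bmatrix}-1&0\\0&1\end{bmatrix}$, $A_3=\begin{bmatrix}0&1\\1&0\end{bmatrix}$. For $A=\begin{bmatrix}a&b\\c&e\end{bmatrix}$ and a matrix polynomial $Q(\lambda)=\sum_{j=0}^{g}\lambda^jQ_j$ of grade $g$, let $\mathbb M_A[Q](\lambda)=\sum_{j=0}^{g}Q_j(a\lambda+b)^j(c\lambda+e)^{g-j}$. Let $L_d(\lambda)\in\mathbb F[\lambda]^{d\times(d+1)}$ have entries $-1$ in the positions $(i,i)$, $\lambda$ in the positions $(i,i+1)$, and $0$ elsewhere, and let $\mathbb M_A[\pm L_d](\lambda^\ell)$ denote the Möbius transform $\mathbb M_A$ of $\pm L_d(\lambda^\ell)$ regarded as a matrix polynomial of grade $\ell$. For either choice of the sign $\pm$,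 set $$\mathcal L(\lambda)=\begin{bmatrix}M(\lambda)&\mathbb M_A[\pm L_d]^\top(\lambda^\ell)\otimes I_n\\ L_d(\lambda^\ell)\otimes I_n&0\end{bmatrix}.$$ Assume that one of the following holds: (i) $M$ satisfies (AS) for $P$, and either $A=A_1$, or $A=A_2$ and $\ell$ is even; (ii) $M$ satisfies (ASS) for $P$, $A=A_2$, and $\ell$ is odd; (iii) $M$ satisfies (DS) for $P$, and $A=A_3$. Then $\mathcal L(\lambda)$ is a strong block minimal bases degree-$\ell$ matrix polynomial, and (a) $\mathcal L(\lambda)$ is a strong $\ell$-ification of $P(\lambda)$ (regarded as a matrix polynomial of grade $k$); (b) the right minimal indices of $\mathcal L(\lambda)$ are exactly $\varepsilon_1+d\ell\le\cdots\le\varepsilon_p+d\ell$, where $\varepsilon_1\le\cdots\le\varepsilon_p$ are the right minimal indices of $P(\lambda)$; (c) the left minimal indices of $\mathcal L(\lambda)$ are exactly $\eta_1+d\ell\le\cdots\le\eta_p+d\ell$, where $\eta_1\le\cdots\le\eta_p$ are the left minimal indices of $P(\lambda)$. Here the following definitions are used. The $i$th row degree of a matrix polynomial is the largest degree of the entries of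 its $i$th row. A matrix polynomial $K(\lambda)\in\mathbb F[\lambda]^{m\times q}$ is a *minimal basis* if the matrix whose $i$th row is the coefficient, in the $i$th row of $K$, of $\lambda$ to the power of the $i$th row degree has rank $m$, and $K(\lambda_0)$ has rank $m$ for every $\lambda_0\in\overline{\mathbb F}$. Minimal bases $K\in\mathbb F[\lambda]^{m_1\times q}$ and $N\in\mathbb F[\lambda]^{m_2\times q}$ are *dual* if $m_1+m_2=q$ and $KN^\top=0$. A grade-$\ell$ matrix polynomial $\begin{bmatrix}M&K_2^\top\\K_1&0\end{bmatrix}$ is a *strong block minimal bases degree-$\ell$ matrix polynomial* if $K_1$ and $K_2$ are minimal bases all of whose row degrees are equal to $\ell$ and, for each $i\in\{1,2\}$, the row degrees of a minimal basis dual to $K_i$ are all equal to each other. A matrix polynomial is *unimodular* if its determinant is a nonzero constant. A matrix polynomial $L$ of grade $\ell$ is an *$\ell$-ification* of a square matrix polynomial $P$ if $ULV=\begin{bmatrix}I_s&0\\0&P\end{bmatrix}$ for some $s\ge0$ and some unimodular $U$, $V$; it is a *strong $\ell$-ification* of $P$, of grade $k$, if moreover $\mathrm{rev}_\ell L$ is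 an $\ell$-ification of $\mathrm{rev}_kP$, where $\mathrm{rev}_g\sum_{j=0}^{g}\lambda^jQ_j=\sum_{j=0}^{g}\lambda^jQ_{g-j}$. The *right minimal indices* of a matrix polynomial $P$ are the row degrees, in nondecreasing order, of any minimal basis whose rows form a basis of $\{x\in\mathbb F(\lambda)^q : Px=0\}$, with $q$ the number of columns of $P$; the *left minimal indices* of $P$ are the right minimal indices of $P^\top$. -/

import Mathlib

open Polynomial
open scoped Kronecker

namespace MatPoly

noncomputable section

variable {F : Type*} [Field F]

/-! ### Grade, reversal, coefficients.  A matrix polynomial is a matrix over `F[X]`. -/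

/-- `P` can be written as `∑_{j ≤ k} λ^j P_j`. -/
def HasGrade {m n : Type*} (k : ℕ) (P : Matrix m n F[X]) : Prop :=
  ∀ i j, (P i j).natDegree ≤ k

/-- The coefficient matrix `P_j` of `λ^j` in `P`. -/
def coeffMat {m n : Type*} (P : Matrix m n F[X]) (j : ℕ) : Matrix m n F :=
  P.map fun p => p.coeff j

/-- The `k`-th reversal `∑_{j ≤ k} λ^j P_{k-j}` of a matrix polynomial of grade `k`. -/
def rev {m n : Type*} (k : ℕ) (P : Matrix m n F[X]) : Matrix m n F[X] :=
  P.map (Polynomial.reflect k)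

/-- `P(λ^ℓ)`. -/
def substPow {m n : Type*} (ℓ : ℕ) (P : Matrix m n F[X]) : Matrix m n F[X] :=
  P.map (Polynomial.expand F ℓ)

/-! ### `ℓ`-ifications -/

/-- The determinant is a nonzero constant. -/
def IsUnimodular {m : Type*} [Fintype m] [DecidableEq m] (U : Matrix m m F[X]) : Prop :=
  ∃ c : F, c ≠ 0 ∧ U.det = C c

/-- `L`, of grade `ℓ`, is an `ℓ`-ification of the square matrix polynomial `P`:
`U L V = diag (I_s, P)` for some `s ≥ 0` and some unimodular `U`, `V`.  The bijection `e` only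
identifies the index set of `L` with that of `diag (I_s, P)`. -/
def IsLification {ρ n : Type*} [Fintype n] [DecidableEq n]
    (ℓ : ℕ) (L : Matrix ρ ρ F[X]) (P : Matrix n n F[X]) : Prop :=
  HasGrade ℓ L ∧
  ∃ (s : ℕ) (e : ρ ≃ Fin s ⊕ n) (U V : Matrix (Fin s ⊕ n) (Fin s ⊕ n) F[X]),
    IsUnimodular U ∧ IsUnimodular V ∧
    U * Matrix.reindex e e L * V = Matrix.fromBlocks 1 0 0 P

/-- `L`, of grade `ℓ`, is a strong `ℓ`-ification of `P`, where `P` is regarded as a matrix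
polynomial of grade `k`. -/
def IsStrongLification {ρ n : Type*} [Fintype n] [DecidableEq n]
    (ℓ k : ℕ) (L : Matrix ρ ρ F[X]) (P : Matrix n n F[X]) : Prop :=
  HasGrade k P ∧ IsLification ℓ L P ∧ IsLification ℓ (rev ℓ L) (rev k P)

/-! ### Minimal bases -/

/-- The degree of the `i`-th row. -/
def rowDegree {m n : Type*} [Fintype n] (P : Matrix m n F[X]) (i : m) : ℕ :=
  Finset.univ.sup fun j => (P i j).natDegree

/-- The highest row degree coefficient matrix. -/
def highestRowCoeff {m n : Type*} [Fintype n] (P : Matrix m n F[X]) : Matrix m n F :=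
  Matrix.of fun i j => (P i j).coeff (rowDegree P i)

/-- Full row rank of the matrix of highest row degree coefficients. -/
def IsRowReduced {m n : Type*} [Fintype m] [Fintype n] (P : Matrix m n F[X]) : Prop :=
  (highestRowCoeff P).rank = Fintype.card m

/-- Minimal basis: row reduced, and of full row rank at every point of the algebraic closure. -/
def IsMinimalBasis {m n : Type*} [Fintype m] [Fintype n] (P : Matrix m n F[X]) : Prop :=
  IsRowReduced P ∧
  ∀ x : AlgebraicClosure F, (P.map fun p => Polynomial.aeval x p).rank = Fintype.card m

/-- Dual minimal bases. -/
def IsDualMinimalBases {m₁ m₂ n : Type*} [Fintype m₁] [Fintype m₂] [Fintype n]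
    (P : Matrix m₁ n F[X]) (Q : Matrix m₂ n F[X]) : Prop :=
  IsMinimalBasis P ∧ IsMinimalBasis Q ∧
  Fintype.card m₁ + Fintype.card m₂ = Fintype.card n ∧ P * Q.transpose = 0

/-- The row degrees of a minimal basis dual to `K` are all equal to each other (all minimal bases
dual to `K` have the same row degrees up to order, so it does not matter which one is taken). -/
def HasDualWithEqualRowDegrees {m n : Type*} [Fintype m] [Fintype n]
    (K : Matrix m n F[X]) : Prop :=
  ∃ (q : ℕ) (N : Matrix (Fin q) n F[X]),
    IsDualMinimalBases K N ∧ ∀ i j, rowDegree N i = rowDegree N j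

/-- Block minimal bases matrix polynomial of grade `ℓ`: a matrix polynomial of grade `ℓ` of the form
`[[M, K₂ᵀ], [K₁, 0]]`, with `K₁` and `K₂` minimal bases. -/
def IsBlockMinimalBases {α β γ δ : Type*} [Fintype α] [Fintype β] [Fintype γ] [Fintype δ]
    (ℓ : ℕ) (L : Matrix (α ⊕ γ) (β ⊕ δ) F[X]) : Prop :=
  HasGrade ℓ L ∧
  L.toBlocks₂₂ = 0 ∧ IsMinimalBasis L.toBlocks₂₁ ∧ IsMinimalBasis L.toBlocks₁₂.transpose

/-- Strong block minimal bases degree-`ℓ` matrix polynomial. -/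
def IsStrongBlockMinimalBases {α β γ δ : Type*} [Fintype α] [Fintype β] [Fintype γ] [Fintype δ]
    (ℓ : ℕ) (L : Matrix (α ⊕ γ) (β ⊕ δ) F[X]) : Prop :=
  IsBlockMinimalBases ℓ L ∧
  (∀ i, rowDegree L.toBlocks₂₁ i = ℓ) ∧ (∀ i, rowDegree L.toBlocks₁₂.transpose i = ℓ) ∧
  HasDualWithEqualRowDegrees L.toBlocks₂₁ ∧ HasDualWithEqualRowDegrees L.toBlocks₁₂.transpose

/-! ### Minimal indices -/

/-- The right null space `{x ∈ F(λ)^n : P x = 0}` over the field of rational functions. -/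
def rightNullSpace {m n : Type*} [Fintype n] (P : Matrix m n F[X]) :
    Submodule (RatFunc F) (n → RatFunc F) :=
  LinearMap.ker (Matrix.mulVecLin (P.map (algebraMap F[X] (RatFunc F))))

/-- `ε₁ ≤ ⋯ ≤ ε_p` are the right minimal indices of `P`: the row degrees of a minimal basis whose
rows form a basis of the right null space of `P`. -/
def AreRightMinimalIndices {m n : Type*} [Fintype n] (P : Matrix m n F[X])
    {p : ℕ} (ε : Fin p → ℕ) : Prop :=
  Monotone ε ∧
  ∃ N : Matrix (Fin p) n F[X],
    IsMinimalBasis N ∧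
    LinearIndependent (RatFunc F) (N.map (algebraMap F[X] (RatFunc F))).row ∧
    Submodule.span (RatFunc F) (Set.range (N.map (algebraMap F[X] (RatFunc F))).row)
      = rightNullSpace P ∧
    ∀ i, rowDegree N i = ε i

/-- `η₁ ≤ ⋯ ≤ η_p` are the left minimal indices of `P`. -/
def AreLeftMinimalIndices {m n : Type*} [Fintype m] (P : Matrix m n F[X])
    {p : ℕ} (η : Fin p → ℕ) : Prop :=
  AreRightMinimalIndices P.transpose η

/-! ### Möbius transformations and the matrix polynomial `ℒ` -/

/-- Möbius transformation of a matrix polynomial of grade `k` induced by `A = [a b; c d]`: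
`∑_{j ≤ k} P_j (a λ + b)^j (c λ + d)^(k-j)`. -/
def mobius {m n : Type*} (A : Matrix (Fin 2) (Fin 2) F) (k : ℕ) (P : Matrix m n F[X]) :
    Matrix m n F[X] :=
  ∑ j ∈ Finset.range (k + 1),
    ((C (A 0 0) * X + C (A 0 1)) ^ j * (C (A 1 0) * X + C (A 1 1)) ^ (k - j)) •
      (coeffMat P j).map C

/-- `A₁`, the matrix of the (skew-)symmetric structures. -/
def A₁ (F : Type*) [Field F] : Matrix (Fin 2) (Fin 2) F := !![1, 0; 0, 1]

/-- `A₂`, the matrix of the alternating structures. -/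
def A₂ (F : Type*) [Field F] : Matrix (Fin 2) (Fin 2) F := !![-1, 0; 0, 1]

/-- `A₃`, the matrix of the (anti-)palindromic structures. -/
def A₃ (F : Type*) [Field F] : Matrix (Fin 2) (Fin 2) F := !![0, 1; 1, 0]

/-- The `d × (d+1)` Kronecker pencil with `-1` on the diagonal and `λ` on the superdiagonal. -/
def kroneckerPencil (F : Type*) [Field F] (d : ℕ) : Matrix (Fin d) (Fin (d + 1)) F[X] :=
  Matrix.of fun i j => if j = i.castSucc then -1 else if j = i.succ then X else 0

/-- `ℒ = [[M, 𝕄_A[± L_d]ᵀ(λ^ℓ) ⊗ I_n], [L_d(λ^ℓ) ⊗ I_n, 0]]`.  The Möbius transformation acts on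
`± L_d(λ^ℓ)` as a matrix polynomial of grade `ℓ`, and `σ` is the sign `±`. -/
def bigL {n d : ℕ} (ℓ : ℕ) (A : Matrix (Fin 2) (Fin 2) F) (σ : ℤˣ)
    (M : Matrix (Fin (d + 1) × Fin n) (Fin (d + 1) × Fin n) F[X]) :
    Matrix ((Fin (d + 1) × Fin n) ⊕ (Fin d × Fin n))
      ((Fin (d + 1) × Fin n) ⊕ (Fin d × Fin n)) F[X] :=
  Matrix.fromBlocks
    M
    ((mobius A ℓ (σ • substPow ℓ (kroneckerPencil F d))).transpose
      ⊗ₖ (1 : Matrix (Fin n) (Fin n) F[X]))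
    (substPow ℓ (kroneckerPencil F d) ⊗ₖ (1 : Matrix (Fin n) (Fin n) F[X]))
    0

/-! ### The three sum conditions.  The blocks are indexed from `0`, that is, the pair
`s t : Fin (d + 1)` stands for the block in position `(s + 1, t + 1)`. -/

/-- The `n × n` block of `M_i` with (zero-based) block indices `s`, `t`. -/
def block {n d : ℕ} (M : Matrix (Fin (d + 1) × Fin n) (Fin (d + 1) × Fin n) F[X])
    (i : ℕ) (s t : Fin (d + 1)) : Matrix (Fin n) (Fin n) F :=
  Matrix.of fun a b => (M (s, a) (t, b)).coeff i

/-- Sum of the blocks of `M_i` in the positions `(s', t')` (counted from `1`) with `s' + t' = w`. -/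
def antidiagSum {n d : ℕ} (M : Matrix (Fin (d + 1) × Fin n) (Fin (d + 1) × Fin n) F[X])
    (i w : ℕ) : Matrix (Fin n) (Fin n) F :=
  ∑ s : Fin (d + 1), ∑ t : Fin (d + 1),
    if ((s : ℕ) + 1) + ((t : ℕ) + 1) = w then block M i s t else 0

/-- Sum of the blocks of `M_i` in the positions `(s', t')` (counted from `1`) with `s' + t' = w`,
each multiplied by `(-1)^(d - s' + 1)`. -/
def signedAntidiagSum {n d : ℕ} (M : Matrix (Fin (d + 1) × Fin n) (Fin (d + 1) × Fin n) F[X])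
    (i w : ℕ) : Matrix (Fin n) (Fin n) F :=
  ∑ s : Fin (d + 1), ∑ t : Fin (d + 1),
    if ((s : ℕ) + 1) + ((t : ℕ) + 1) = w then (-1 : F) ^ (d - (s : ℕ)) • block M i s t else 0

/-- Sum of the blocks of `M_i` in the positions `(s', t')` with `s' - t' = w`. -/
def diagSum {n d : ℕ} (M : Matrix (Fin (d + 1) × Fin n) (Fin (d + 1) × Fin n) F[X])
    (i : ℕ) (w : ℤ) : Matrix (Fin n) (Fin n) F :=
  ∑ s : Fin (d + 1), ∑ t : Fin (d + 1),
    if ((s : ℕ) : ℤ) - ((t : ℕ) : ℤ) = w then block M i s t else 0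

/-- The anti-diagonal sum condition of `M` for `P`. -/
def AS {n d : ℕ} (ℓ : ℕ) (M : Matrix (Fin (d + 1) × Fin n) (Fin (d + 1) × Fin n) F[X])
    (P : Matrix (Fin n) (Fin n) F[X]) : Prop :=
  (∀ r ≤ 2 * d + 1, coeffMat P (ℓ * r) =
    antidiagSum M 0 (2 * d + 2 - r) + antidiagSum M ℓ (2 * d + 3 - r)) ∧
  (∀ r ≤ 2 * d, ∀ c, 1 ≤ c → c < ℓ → coeffMat P (ℓ * r + c) = antidiagSum M c (2 * d + 2 - r))

/-- The anti-diagonal signed sum condition of `M` for `P`. -/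
def ASS {n d : ℕ} (ℓ : ℕ) (M : Matrix (Fin (d + 1) × Fin n) (Fin (d + 1) × Fin n) F[X])
    (P : Matrix (Fin n) (Fin n) F[X]) : Prop :=
  (∀ r ≤ 2 * d + 1, coeffMat P (ℓ * r) =
    signedAntidiagSum M 0 (2 * d + 2 - r) + signedAntidiagSum M ℓ (2 * d + 3 - r)) ∧
  (∀ r ≤ 2 * d, ∀ c, 1 ≤ c → c < ℓ →
    coeffMat P (ℓ * r + c) = signedAntidiagSum M c (2 * d + 2 - r))

/-- The diagonal sum condition of `M` for `P`. -/
def DS {n d : ℕ} (ℓ : ℕ) (M : Matrix (Fin (d + 1) × Fin n) (Fin (d + 1) × Fin n) F[X])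
    (P : Matrix (Fin n) (Fin n) F[X]) : Prop :=
  (∀ r ≤ 2 * d + 1, coeffMat P (ℓ * r) =
    diagSum M 0 ((r : ℤ) - d) + diagSum M ℓ ((r : ℤ) - d - 1)) ∧
  (∀ r ≤ 2 * d, ∀ c, 1 ≤ c → c < ℓ → coeffMat P (ℓ * r + c) = diagSum M c ((r : ℤ) - d))

end

end MatPoly

/-! Write `K₁`, `K₂` for the outer blocks of `ℒ = [[M, K₂ᵀ], [K₁, 0]]`. In all cases each is, up to
sign and `⊗ I_n`, the bidiagonal matrix with `-u` on the diagonal and `w` above it, where `(u, w)`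
is `(1, c λ^ℓ)` or `(λ^ℓ, c)` with `c = ±1`. Its kernel is spanned by the vector `N` with entries
`u^j w^(d-j)`, and the sum conditions say exactly that `N₂ M N₁ᵀ = P`: every entry product of the
two kernels is a signed power of `λ^ℓ`, and a condition compares coefficients.

Since one of `u`, `w` is a unit, `[K; Y]` has the explicit polynomial inverse `[R, Nᵀ]`
(`IsSplitting`). Block elimination with these matrices takes `ℒ` to `diag (1, P)` by invertible
factors (`IsSplitBlock.exists_equivalence`), so `ℒ` is an `ℓ`-ification. Reversal interchanges the
two kinds of pair and turns `N₂ M N₁ᵀ = P` into the same identity for the reversals, so the same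
argument makes `rev ℒ` an `ℓ`-ification of `rev P`.

For the minimal indices, `B = [N₁ᵀ; -R₂ᵀ M N₁ᵀ]` maps the kernel of `P` bijectively onto that of `ℒ`
and has a polynomial left inverse (`IsKernelTransfer`). On the kernel it raises degrees by exactly
`d ℓ` (`IsSplitBlock.shiftsDegree`): the leading coefficients of `N₁` do not cancel, and those of
`K₂` keep the lower component from having larger degree than the upper one. A degree-shifting
isomorphism carries minimal bases to minimal bases in both directions. Left indices follow by
transposition, which exchanges the outer blocks. -/

namespace MatPoly

open Matrix

/-! ### Splittings and block elimination over a commutative ring. -/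

/-- `K` and `N` have right inverses `R` and `Yᵀ` that turn `[K; Y]` and `[R, Nᵀ]` into mutually
inverse matrices. -/
structure IsSplitting {S α β γ : Type*} [CommRing S] [Fintype α] [Fintype β] [Fintype γ]
    [DecidableEq α] [DecidableEq β] [DecidableEq γ]
    (K : Matrix γ α S) (N Y : Matrix β α S) (R : Matrix α γ S) : Prop where
  mul_right : K * R = 1
  mul_dual : K * Nᵀ = 0
  compl_right : Y * R = 0
  compl_dual : Y * Nᵀ = 1
  complete : R * K + Nᵀ * Y = 1

theorem mul_submatrix_id {S ι κ μ ν : Type*} [CommRing S] [Fintype κ] (D : Matrix ι κ S)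
    (B : Matrix κ μ S) (f : ν → μ) : D * B.submatrix id f = (D * B).submatrix id f := rfl

theorem submatrix_id_mul {S ι κ μ ν : Type*} [CommRing S] [Fintype κ] (D : Matrix ι κ S)
    (B : Matrix κ μ S) (f : ν → ι) : D.submatrix f id * B = (D * B).submatrix f id := rfl

namespace IsSplitting

variable {S α β γ : Type*} [CommRing S] [Fintype α] [Fintype β] [Fintype γ]
  [DecidableEq α] [DecidableEq β] [DecidableEq γ]
  {K : Matrix γ α S} {N Y : Matrix β α S} {R : Matrix α γ S}

/-- The first four identities say `[K; Y] * [R, Nᵀ] = 1`. When the sizes make these factors square,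
a one-sided inverse over a commutative ring is two-sided, which yields completeness. -/
theorem of_card (hc : Fintype.card γ + Fintype.card β = Fintype.card α)
    (h1 : K * R = 1) (h2 : K * Nᵀ = 0) (h3 : Y * R = 0) (h4 : Y * Nᵀ = 1) :
    IsSplitting K N Y R := by
  refine ⟨h1, h2, h3, h4, ?_⟩
  have e : α ≃ γ ⊕ β := Fintype.equivOfCardEq (by simp [hc])
  rw [← fromCols_mul_fromRows, fromCols_mul_fromRows_eq_one_comm e, fromRows_mul_fromCols,
    h1, h2, h3, h4, fromBlocks_one]

theorem smul (h : IsSplitting K N Y R) {a b : S} (hab : a * b = 1) :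
    IsSplitting (a • K) N Y (b • R) := by
  have hba : b * a = 1 := by rw [mul_comm, hab]
  refine ⟨?_, ?_, ?_, ?_, ?_⟩ <;>
    simp [smul_smul, hab, hba, h.mul_right, h.mul_dual, h.compl_right, h.compl_dual, h.complete]

theorem kronecker {ν : Type*} [Fintype ν] [DecidableEq ν] {N Y : Matrix Unit α S}
    (h : IsSplitting K N Y R) :
    IsSplitting (K ⊗ₖ (1 : Matrix ν ν S))
      ((N ⊗ₖ (1 : Matrix ν ν S)).submatrix (Equiv.punitProd ν).symm id)
      ((Y ⊗ₖ (1 : Matrix ν ν S)).submatrix (Equiv.punitProd ν).symm id)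
      (R ⊗ₖ (1 : Matrix ν ν S)) := by
  have e1 : ∀ (B : Matrix Unit α S), ((B ⊗ₖ (1 : Matrix ν ν S)).submatrix
      (Equiv.punitProd ν).symm id)ᵀ
      = (Bᵀ ⊗ₖ (1 : Matrix ν ν S)).submatrix id (Equiv.punitProd ν).symm := by
    intro B
    rw [transpose_submatrix, ← kroneckerMap_transpose, transpose_one]
  refine ⟨?_, ?_, ?_, ?_, ?_⟩
  · rw [← mul_kronecker_mul, h.mul_right, Matrix.one_mul, one_kronecker_one]
  · rw [e1, mul_submatrix_id, ← mul_kronecker_mul, h.mul_dual, zero_kronecker]; rfl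
  · rw [submatrix_id_mul, ← mul_kronecker_mul, h.compl_right, zero_kronecker]; rfl
  · rw [e1, mul_submatrix_id, submatrix_id_mul, ← mul_kronecker_mul, h.compl_dual, Matrix.one_mul, one_kronecker_one,
      submatrix_submatrix]
    exact submatrix_one_equiv _
  · rw [e1, submatrix_mul_equiv, ← mul_kronecker_mul, ← mul_kronecker_mul, submatrix_id_id,
      ← add_kronecker, h.complete, Matrix.one_mul, one_kronecker_one]

end IsSplitting

section Block

variable {S α α' β γ δ : Type*} [CommRing S] [Fintype α] [Fintype α'] [Fintype β] [Fintype γ]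
  [Fintype δ] [DecidableEq α] [DecidableEq α'] [DecidableEq β] [DecidableEq γ] [DecidableEq δ]
  {K₁ : Matrix γ α S} {N₁ Y₁ : Matrix β α S} {R₁ : Matrix α γ S}
  {K₂ : Matrix δ α' S} {N₂ Y₂ : Matrix β α' S} {R₂ : Matrix α' δ S}
  {M : Matrix α' α S} {P : Matrix β β S}

/-- The matrices of a strong block minimal bases polynomial, with bases of its outer blocks. -/
structure IsSplitBlock (K₁ : Matrix γ α S) (N₁ Y₁ : Matrix β α S) (R₁ : Matrix α γ S)
    (K₂ : Matrix δ α' S) (N₂ Y₂ : Matrix β α' S) (R₂ : Matrix α' δ S)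
    (M : Matrix α' α S) (P : Matrix β β S) : Prop where
  fst : IsSplitting K₁ N₁ Y₁ R₁
  snd : IsSplitting K₂ N₂ Y₂ R₂
  eq : N₂ * M * N₁ᵀ = P

theorem IsSplitting.dual_mul (h : IsSplitting K₂ N₂ Y₂ R₂) : N₂ * K₂ᵀ = 0 := by
  simpa using congrArg transpose h.mul_dual

theorem IsSplitting.right_mul (h : IsSplitting K₂ N₂ Y₂ R₂) : R₂ᵀ * K₂ᵀ = 1 := by
  simpa using congrArg transpose h.mul_right

theorem IsSplitting.dual_compl (h : IsSplitting K₂ N₂ Y₂ R₂) : N₂ * Y₂ᵀ = 1 := by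
  simpa using congrArg transpose h.compl_dual

theorem IsSplitting.right_compl (h : IsSplitting K₂ N₂ Y₂ R₂) : R₂ᵀ * Y₂ᵀ = 0 := by
  simpa using congrArg transpose h.compl_right

theorem IsSplitting.complete_transpose (h : IsSplitting K₂ N₂ Y₂ R₂) :
    K₂ᵀ * R₂ᵀ + Y₂ᵀ * N₂ = 1 := by
  simpa using congrArg transpose h.complete

theorem IsSplitting.dual_compl_mul (h : IsSplitting K₁ N₁ Y₁ R₁) : N₁ᵀ * Y₁ = 1 - R₁ * K₁ :=
  eq_sub_of_add_eq' h.complete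

namespace IsSplitBlock

theorem transpose (h : IsSplitBlock K₁ N₁ Y₁ R₁ K₂ N₂ Y₂ R₂ M P) :
    IsSplitBlock K₂ N₂ Y₂ R₂ K₁ N₁ Y₁ R₁ Mᵀ Pᵀ :=
  ⟨h.snd, h.fst, by rw [← h.eq]; simp [Matrix.mul_assoc]⟩

/-- The block matrix is equivalent to `diag (1, P)`. -/
theorem exists_equivalence (h : IsSplitBlock K₁ N₁ Y₁ R₁ K₂ N₂ Y₂ R₂ M P) :
    ∃ (U : Matrix ((δ ⊕ γ) ⊕ β) (α' ⊕ γ) S) (U' : Matrix (α' ⊕ γ) ((δ ⊕ γ) ⊕ β) S)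
      (V : Matrix (α ⊕ δ) ((δ ⊕ γ) ⊕ β) S) (V' : Matrix ((δ ⊕ γ) ⊕ β) (α ⊕ δ) S),
      U * U' = 1 ∧ V' * V = 1 ∧ U * fromBlocks M K₂ᵀ K₁ 0 * V = fromBlocks 1 0 0 P := by
  -- `R₂ᵀ` and `N₂` split the upper rows, and `R₁` and `N₁ᵀ` split the left columns. The terms
  -- containing `M` are the row and column operations that clear all entries of `M` except `N₂ M
  -- N₁ᵀ`.
  refine ⟨fromRows (fromBlocks R₂ᵀ (-(R₂ᵀ * M * R₁)) 0 1) (fromCols N₂ (-(N₂ * M * R₁))),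
    fromCols (fromBlocks K₂ᵀ (M * R₁) 0 1) (fromRows Y₂ᵀ 0),
    fromCols (fromBlocks 0 R₁ 1 0) (fromRows N₁ᵀ (-(R₂ᵀ * M * N₁ᵀ))),
    fromRows (fromBlocks (R₂ᵀ * M * N₁ᵀ * Y₁) 1 K₁ 0) (fromCols Y₁ 0), ?_, ?_, ?_⟩
  · rw [fromRows_mul_fromCols, fromBlocks_multiply, fromBlocks_mul_fromRows,
      fromCols_mul_fromBlocks, fromCols_mul_fromRows]
    simp [h.snd.right_mul, h.snd.right_compl, h.snd.dual_mul, h.snd.dual_compl,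
      Matrix.mul_assoc]
  · rw [fromRows_mul_fromCols, fromBlocks_multiply, fromBlocks_mul_fromRows,
      fromCols_mul_fromBlocks, fromCols_mul_fromRows]
    simp [h.fst.mul_right, h.fst.mul_dual, h.fst.compl_right, h.fst.compl_dual, Matrix.mul_assoc]
  · have e : N₂ * (M * N₁ᵀ) = P := by rw [← h.eq, Matrix.mul_assoc]
    rw [fromRows_mul, fromBlocks_multiply, fromCols_mul_fromBlocks, fromRows_mul_fromCols,
      fromBlocks_multiply, fromBlocks_mul_fromRows, fromCols_mul_fromBlocks, fromCols_mul_fromRows]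
    simp [h.snd.right_mul, h.snd.dual_mul, h.fst.mul_right, h.fst.mul_dual, Matrix.mul_assoc,
      Matrix.add_mul, e]

end IsSplitBlock

/-- Identities which identify the kernels of `P` and `L` by means of the matrices `B`, `C`. -/
structure IsKernelTransfer {ι κ μ ν : Type*} [Fintype ι] [Fintype κ] [Fintype μ] [Fintype ν]
    [DecidableEq κ] [DecidableEq ν] (L : Matrix ι κ S) (P : Matrix μ ν S) (B : Matrix κ ν S)
    (C : Matrix ν κ S) : Prop where
  left_inv : C * B = 1
  mul_eq : ∃ Q : Matrix ι μ S, L * B = Q * P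
  right_inv : ∃ T : Matrix κ ι S, B * C + T * L = 1
  mul_left_inv : ∃ Q : Matrix μ ι S, P * C = Q * L

/-- Being matrix identities, the kernel correspondence survives any ring map. It is used over `F[X]`
for polynomial kernel vectors and over `RatFunc F` for the null spaces. -/
theorem IsKernelTransfer.map {S' ι κ μ ν : Type*} [CommRing S'] [Fintype ι] [Fintype κ]
    [Fintype μ] [Fintype ν] [DecidableEq κ] [DecidableEq ν] {L : Matrix ι κ S}
    {P : Matrix μ ν S} {B : Matrix κ ν S} {C : Matrix ν κ S} (h : IsKernelTransfer L P B C)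
    (f : S →+* S') : IsKernelTransfer (L.map f) (P.map f) (B.map f) (C.map f) := by
  obtain ⟨h1, ⟨Q, h2⟩, ⟨T, h3⟩, ⟨Q', h4⟩⟩ := h
  refine ⟨?_, ⟨Q.map f, ?_⟩, ⟨T.map f, ?_⟩, ⟨Q'.map f, ?_⟩⟩
  · rw [← Matrix.map_mul, h1, Matrix.map_one _ f.map_zero f.map_one]
  · rw [← Matrix.map_mul, h2, Matrix.map_mul]
  · rw [← Matrix.map_mul, ← Matrix.map_mul, ← Matrix.map_add _ f.map_add, h3,
      Matrix.map_one _ f.map_zero f.map_one]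
  · rw [← Matrix.map_mul, h4, Matrix.map_mul]

theorem IsSplitBlock.isKernelTransfer (h : IsSplitBlock K₁ N₁ Y₁ R₁ K₂ N₂ Y₂ R₂ M P) :
    IsKernelTransfer (fromBlocks M K₂ᵀ K₁ 0) P (fromRows N₁ᵀ (-(R₂ᵀ * M * N₁ᵀ)))
      (fromCols Y₁ 0) := by
  have e : N₂ * (M * N₁ᵀ) = P := by rw [← h.eq, Matrix.mul_assoc]
  refine ⟨?_, ⟨fromRows Y₂ᵀ 0, ?_⟩, ⟨fromBlocks 0 R₁ R₂ᵀ (-(R₂ᵀ * M * R₁)), ?_⟩,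
    ⟨fromCols N₂ (-(N₂ * M * R₁)), ?_⟩⟩
  · rw [fromCols_mul_fromRows]; simp [h.fst.compl_dual]
  -- Decompose `M N₁ᵀ` along the splitting of the identity by `K₂ᵀ R₂ᵀ` and `Y₂ᵀ N₂`; the second
  -- part is `Y₂ᵀ P`.
  · have e' : K₂ᵀ * (R₂ᵀ * (M * N₁ᵀ)) = M * N₁ᵀ - Y₂ᵀ * P := by
      rw [← e, eq_sub_iff_add_eq]
      simp only [← Matrix.mul_assoc, ← Matrix.add_mul]
      rw [h.snd.complete_transpose, Matrix.one_mul]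
    rw [fromBlocks_mul_fromRows, fromRows_mul]
    simp [h.fst.mul_dual, Matrix.mul_assoc, e']
  · rw [fromRows_mul_fromCols, fromBlocks_multiply, fromBlocks_add]
    simp only [h.fst.dual_compl_mul, h.snd.right_mul, Matrix.mul_assoc]
    rw [← fromBlocks_one]
    congr 1 <;> simp [Matrix.mul_assoc, Matrix.mul_sub, h.fst.dual_compl_mul]
    abel
  · rw [mul_fromCols, fromCols_mul_fromBlocks, ← e]
    simp [Matrix.mul_assoc, h.fst.dual_compl_mul, h.snd.dual_mul, Matrix.mul_add, sub_eq_add_neg]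

end Block

end MatPoly

/-! ### Minimal bases and minimal indices under a degree-shifting kernel isomorphism. -/

namespace MatPoly

open Matrix

variable {F : Type*} [Field F]

theorem rank_eq_card_iff {K m n : Type*} [Field K] [Fintype m] [Fintype n] (A : Matrix m n K) :
    A.rank = Fintype.card m ↔ ∀ c : m → K, c ᵥ* A = 0 → c = 0 := by
  have : A.rank = Fintype.card m ↔ LinearIndependent K A.row := by
    rw [linearIndependent_iff_card_eq_finrank_span, A.rank_eq_finrank_span_row, Set.finrank,
      eq_comm]
  rw [this, ← vecMul_injective_iff, ← coe_vecMulLinear, ← LinearMap.ker_eq_bot,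
    LinearMap.ker_eq_bot']
  rfl

theorem degree_lt_iff_coeff_eq_zero {p : F[X]} {D : ℕ} (h : p.natDegree ≤ D) :
    p.degree < D ↔ p.coeff D = 0 := by
  rw [degree_lt_iff_coeff_zero]
  refine ⟨fun h' ↦ h' D le_rfl, fun h' j hj ↦ ?_⟩
  rcases hj.eq_or_lt with rfl | hj
  · exact h'
  · exact coeff_eq_zero_of_natDegree_lt (h.trans_lt hj)

theorem natDegree_le_rowDegree {m n : Type*} [Fintype n] (N : Matrix m n F[X]) (i : m) (j : n) :
    (N i j).natDegree ≤ rowDegree N i :=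
  Finset.le_sup (f := fun j ↦ (N i j).natDegree) (Finset.mem_univ j)

/-- A zero row must be excluded: its entries have degree `⊥`, while `rowDegree` gives it the default
value `0`, so the equivalence would fail at `D = 0`. -/
theorem forall_degree_lt_iff {m n : Type*} [Fintype n] {N : Matrix m n F[X]} {i : m}
    (hi : N i ≠ 0) (D : ℕ) : (∀ j, (N i j).degree < D) ↔ rowDegree N i < D := by
  cases D with
  | zero =>
    simp only [Nat.cast_zero, not_lt_zero, iff_false]
    exact fun h ↦ hi (funext fun j ↦ degree_eq_bot.1 (Nat.WithBot.lt_zero_iff.1 (h j)))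
  | succ D =>
    rw [Nat.lt_succ_iff, rowDegree, Finset.sup_le_iff]
    simp only [Finset.mem_univ, forall_const, degree_lt_iff_coeff_zero,
      natDegree_le_iff_coeff_eq_zero, Nat.succ_le_iff]

theorem coeff_vecMul_eq {m n : Type*} [Fintype m] [Fintype n] (N : Matrix m n F[X]) {D : ℕ}
    (hD : ∀ i, rowDegree N i ≤ D) (c : m → F) (j : n) :
    (((fun i ↦ C (c i) * X ^ (D - rowDegree N i)) ᵥ* N) j).coeff D
      = (c ᵥ* highestRowCoeff N) j := by
  simp only [vecMul, dotProduct, finsetSum_coeff, highestRowCoeff, of_apply]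
  refine Finset.sum_congr rfl fun i _ ↦ ?_
  rw [mul_assoc, coeff_C_mul]
  nth_rw 2 [← Nat.add_sub_of_le (hD i)]
  rw [coeff_X_pow_mul]

theorem natDegree_vecMul_le {m n : Type*} [Fintype m] [Fintype n] (N : Matrix m n F[X]) {D : ℕ}
    (hD : ∀ i, rowDegree N i ≤ D) (c : m → F) (j : n) :
    (((fun i ↦ C (c i) * X ^ (D - rowDegree N i)) ᵥ* N) j).natDegree ≤ D := by
  simp only [vecMul, dotProduct]
  refine natDegree_sum_le_of_forall_le _ _ fun i _ ↦ ?_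
  refine natDegree_mul_le.trans ?_
  have h1 := natDegree_C_mul_X_pow_le (c i) (D - rowDegree N i)
  have h2 := natDegree_le_rowDegree N i j
  have h3 := hD i
  omega

/-- Padding row `i` by `λ^(D - deg)` brings all leading coefficients to `λ^D`, so a relation among
them is a degree drop of the combination. Row reducedness thus becomes a statement about degrees of
vectors in the row span, which `ShiftsDegree` can transport. -/
theorem isRowReduced_iff {m n : Type*} [Fintype m] [Fintype n] (N : Matrix m n F[X]) {D : ℕ}
    (hD : ∀ i, rowDegree N i ≤ D) :
    IsRowReduced N ↔ ∀ c : m → F,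
      (∀ j, (((fun i ↦ C (c i) * X ^ (D - rowDegree N i)) ᵥ* N) j).degree < D) → c = 0 := by
  rw [IsRowReduced, rank_eq_card_iff]
  refine forall_congr' fun c ↦ ?_
  simp only [degree_lt_iff_coeff_eq_zero (natDegree_vecMul_le N hD c _), coeff_vecMul_eq N hD]
  rw [funext_iff]
  rfl

theorem IsRowReduced.row_ne_zero {m n : Type*} [Fintype m] [Fintype n] {N : Matrix m n F[X]}
    (h : IsRowReduced N) (i : m) : N i ≠ 0 := by
  classical
  intro h0
  rw [IsRowReduced, rank_eq_card_iff] at h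
  have := congrFun (h (Pi.single i 1) (by
    ext j
    simp [highestRowCoeff, h0])) i
  simp at this

/-- On the kernel of `P`, multiplication by `B` raises the degrees by exactly `s`. -/
def ShiftsDegree {μ ν κ : Type*} [Fintype ν] (P : Matrix μ ν F[X]) (B : Matrix κ ν F[X])
    (s : ℕ) : Prop :=
  ∀ w : ν → F[X], P *ᵥ w = 0 → ∀ D : ℕ,
    (∀ a, (w a).degree < D) ↔ ∀ j, ((B *ᵥ w) j).degree < (D + s : ℕ)

theorem vecMul_mul_transpose {m ν κ : Type*} [Fintype ν] [Fintype m] (N : Matrix m ν F[X])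
    (B : Matrix κ ν F[X]) (c : m → F[X]) : c ᵥ* (N * Bᵀ) = B *ᵥ (c ᵥ* N) := by
  rw [← vecMul_vecMul, vecMul_transpose]

theorem mul_transpose_row {m ν κ : Type*} [Fintype ν] (N : Matrix m ν F[X])
    (B : Matrix κ ν F[X]) (i : m) : (N * Bᵀ) i = B *ᵥ N i := by
  ext1 j
  simp [mul_apply, mulVec, dotProduct, mul_comm]

theorem mulVec_vecMul_eq_zero {μ ν m : Type*} [Fintype ν] [Fintype m]
    {P : Matrix μ ν F[X]} {N : Matrix m ν F[X]} (hN : ∀ i, P *ᵥ N i = 0) (c : m → F[X]) :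
    P *ᵥ (c ᵥ* N) = 0 := by
  have : N * Pᵀ = 0 := by
    ext1 i j
    rw [mul_apply]
    simpa [mulVec, dotProduct, mul_comm] using congrFun (hN i) j
  rw [← vecMul_transpose, vecMul_vecMul, this, vecMul_zero]

theorem ShiftsDegree.rowDegree_eq {μ ν κ m : Type*} [Fintype ν] [Fintype κ]
    {P : Matrix μ ν F[X]} {B : Matrix κ ν F[X]} {s : ℕ} (h : ShiftsDegree P B s) {N : Matrix m ν F[X]}
    (hN : ∀ i, P *ᵥ N i = 0) {i : m} (h1 : N i ≠ 0) (h2 : (N * Bᵀ) i ≠ 0) :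
    rowDegree (N * Bᵀ) i = rowDegree N i + s := by
  have key : ∀ D : ℕ, rowDegree N i < D ↔ rowDegree (N * Bᵀ) i < D + s := by
    intro D
    rw [← forall_degree_lt_iff h1, ← forall_degree_lt_iff h2, h _ (hN i) D, mul_transpose_row]
  -- These two values of `D` give the lower and the upper bound.
  have k1 := key (rowDegree N i)
  have k2 := key (rowDegree N i + 1)
  omega

section Shift

variable {μ ν κ m : Type*} [Fintype ν] [Fintype κ] [Fintype m] {P : Matrix μ ν F[X]}
  {B : Matrix κ ν F[X]} {s : ℕ}

theorem ShiftsDegree.isRowReduced_iff (h : ShiftsDegree P B s) {N : Matrix m ν F[X]}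
    (hN : ∀ i, P *ᵥ N i = 0) (h1 : ∀ i, N i ≠ 0) (h2 : ∀ i, (N * Bᵀ) i ≠ 0) :
    IsRowReduced (N * Bᵀ) ↔ IsRowReduced N := by
  set D := Finset.univ.sup (rowDegree N)
  have hD : ∀ i, rowDegree N i ≤ D := fun i ↦ Finset.le_sup (Finset.mem_univ i)
  have e := fun i ↦ h.rowDegree_eq hN (h1 i) (h2 i)
  rw [MatPoly.isRowReduced_iff N hD, MatPoly.isRowReduced_iff (N * Bᵀ) (D := D + s)
    fun i ↦ by rw [e]; exact Nat.add_le_add_right (hD i) s]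
  refine forall_congr' fun c ↦ ?_
  rw [h _ (mulVec_vecMul_eq_zero hN _) D]
  simp only [vecMul_mul_transpose, e, Nat.add_sub_add_right]

/-- The polynomial left inverse of `B` specializes at every point of the algebraic closure, so
multiplication by `Bᵀ` preserves pointwise rank; row reducedness is a matter of degrees. -/
theorem ShiftsDegree.isMinimalBasis_iff [DecidableEq ν] (h : ShiftsDegree P B s)
    {G : Matrix ν κ F[X]}
    (hG : G * B = 1) {N : Matrix m ν F[X]} (hN : ∀ i, P *ᵥ N i = 0) (h1 : ∀ i, N i ≠ 0)
    (h2 : ∀ i, (N * Bᵀ) i ≠ 0) : IsMinimalBasis (N * Bᵀ) ↔ IsMinimalBasis N := by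
  rw [IsMinimalBasis, IsMinimalBasis, h.isRowReduced_iff hN h1 h2]
  refine and_congr_right fun _ ↦ forall_congr' fun x ↦ ?_
  let f : F[X] →+* AlgebraicClosure F := (aeval x : F[X] →ₐ[F] AlgebraicClosure F).toRingHom
  change ((N * Bᵀ).map f).rank = _ ↔ (N.map f).rank = _
  have e1 : (N * Bᵀ).map f = N.map f * (Bᵀ).map f := Matrix.map_mul
  have e2 : (Bᵀ).map f * (Gᵀ).map f = 1 := by
    rw [← Matrix.map_mul, ← transpose_mul, hG, transpose_one,
      Matrix.map_one _ f.map_zero f.map_one]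
  have e3 : ((N * Bᵀ).map f).rank = (N.map f).rank := by
    refine le_antisymm (e1 ▸ rank_mul_le_left _ _) ?_
    calc (N.map f).rank = ((N * Bᵀ).map f * (Gᵀ).map f).rank := by
          rw [e1, Matrix.mul_assoc, e2, Matrix.mul_one]
      _ ≤ _ := rank_mul_le_left _ _
  rw [e3]

end Shift

theorem mulVec_row_eq_zero {μ ν : Type*} [Fintype ν] {P : Matrix μ ν F[X]} {p : ℕ}
    {N : Matrix (Fin p) ν F[X]}
    (hN : Submodule.span (RatFunc F) (Set.range (N.map (algebraMap F[X] (RatFunc F))).row)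
      = rightNullSpace P) (i : Fin p) : P *ᵥ N i = 0 := by
  have hi : (N.map (algebraMap F[X] (RatFunc F))).row i ∈ rightNullSpace P :=
    hN ▸ Submodule.subset_span ⟨i, rfl⟩
  rw [rightNullSpace, LinearMap.mem_ker, mulVecLin_apply] at hi
  ext1 j
  refine IsFractionRing.injective F[X] (RatFunc F) ?_
  rw [Pi.zero_apply, map_zero, RingHom.map_mulVec]
  exact congrFun hi j

section Transfer

variable {ι κ μ ν : Type*} [Fintype ι] [Fintype κ] [Fintype μ] [Fintype ν] [DecidableEq κ]
  [DecidableEq ν]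

theorem IsKernelTransfer.mulVec_eq_zero {S : Type*} [CommRing S] {L : Matrix ι κ S}
    {P : Matrix μ ν S} {B : Matrix κ ν S} {G : Matrix ν κ S} (h : IsKernelTransfer L P B G)
    {w : ν → S} (hw : P *ᵥ w = 0) : L *ᵥ (B *ᵥ w) = 0 := by
  obtain ⟨Q, hQ⟩ := h.mul_eq
  rw [mulVec_mulVec, hQ, ← mulVec_mulVec, hw, mulVec_zero]

theorem IsKernelTransfer.mulVec_left_inv {S : Type*} [CommRing S] {L : Matrix ι κ S}
    {P : Matrix μ ν S} {B : Matrix κ ν S} {G : Matrix ν κ S} (h : IsKernelTransfer L P B G)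
    {v : κ → S} (hv : L *ᵥ v = 0) : P *ᵥ (G *ᵥ v) = 0 ∧ B *ᵥ (G *ᵥ v) = v := by
  obtain ⟨Q, hQ⟩ := h.mul_left_inv
  obtain ⟨T, hT⟩ := h.right_inv
  refine ⟨by rw [mulVec_mulVec, hQ, ← mulVec_mulVec, hv, mulVec_zero], ?_⟩
  rw [mulVec_mulVec]
  conv_rhs => rw [← one_mulVec v, ← hT, add_mulVec, ← mulVec_mulVec v T, hv, mulVec_zero, add_zero]

theorem IsKernelTransfer.injective {S : Type*} [CommRing S] {L : Matrix ι κ S}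
    {P : Matrix μ ν S} {B : Matrix κ ν S} {G : Matrix ν κ S} (h : IsKernelTransfer L P B G) :
    Function.Injective (mulVecLin B) := by
  intro w w' hw
  have := congrArg (G *ᵥ ·) hw
  simpa [mulVec_mulVec, h.left_inv] using this

variable {L : Matrix ι κ F[X]} {P : Matrix μ ν F[X]} {B : Matrix κ ν F[X]} {G : Matrix ν κ F[X]}

theorem IsKernelTransfer.rightNullSpace_eq (h : IsKernelTransfer L P B G) :
    rightNullSpace L = (rightNullSpace P).map
      (mulVecLin (B.map (algebraMap F[X] (RatFunc F)))) := by
  have h' := h.map (algebraMap F[X] (RatFunc F))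
  ext v
  simp only [rightNullSpace, Submodule.mem_map, LinearMap.mem_ker, mulVecLin_apply]
  constructor
  · exact fun hv ↦ ⟨_, h'.mulVec_left_inv hv⟩
  · rintro ⟨w, hw, rfl⟩
    exact h'.mulVec_eq_zero hw

theorem IsKernelTransfer.isBasis_iff (h : IsKernelTransfer L P B G) {p : ℕ}
    (N : Matrix (Fin p) ν F[X]) :
    (LinearIndependent (RatFunc F) ((N * Bᵀ).map (algebraMap F[X] (RatFunc F))).row ∧
      Submodule.span (RatFunc F) (Set.range ((N * Bᵀ).map (algebraMap F[X] (RatFunc F))).row)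
        = rightNullSpace L) ↔
    (LinearIndependent (RatFunc F) (N.map (algebraMap F[X] (RatFunc F))).row ∧
      Submodule.span (RatFunc F) (Set.range (N.map (algebraMap F[X] (RatFunc F))).row)
        = rightNullSpace P) := by
  have hinj := (h.map (algebraMap F[X] (RatFunc F))).injective
  have e : ((N * Bᵀ).map (algebraMap F[X] (RatFunc F))).row
      = mulVecLin (B.map (algebraMap F[X] (RatFunc F))) ∘
        (N.map (algebraMap F[X] (RatFunc F))).row := by
    ext1 i
    change (algebraMap F[X] (RatFunc F)) ∘ ((N * Bᵀ) i) = _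
    rw [mul_transpose_row]
    ext1 j
    exact RingHom.map_mulVec _ _ _ _
  rw [e, Set.range_comp, Submodule.span_image, h.rightNullSpace_eq,
    (Submodule.map_injective_of_injective hinj).eq_iff,
    LinearMap.linearIndependent_iff _ (LinearMap.ker_eq_bot.2 hinj)]

theorem IsKernelTransfer.areRightMinimalIndices_iff (h : IsKernelTransfer L P B G) {s : ℕ}
    (hs : ShiftsDegree P B s) (p : ℕ) (δ : Fin p → ℕ) :
    AreRightMinimalIndices L δ ↔
      ∃ ε : Fin p → ℕ, AreRightMinimalIndices P ε ∧ δ = fun i ↦ ε i + s := by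
  have ne_iff : ∀ (N : Matrix (Fin p) ν F[X]) (i : Fin p), (N * Bᵀ) i ≠ 0 ↔ N i ≠ 0 := by
    intro N i
    rw [mul_transpose_row, ← mulVecLin_apply, Ne, Ne, LinearMap.map_eq_zero_iff _ h.injective]
  constructor
  · rintro ⟨hmono, N', hmin, hli, hspan, hdeg⟩
    have hL := mulVec_row_eq_zero hspan
    obtain ⟨N, rfl⟩ : ∃ N : Matrix (Fin p) ν F[X], N' = N * Bᵀ := by
      -- `B G` fixes every kernel vector of `L`, so applying the polynomial matrix `G` to the rows
      -- gives preimages with polynomial entries.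
      refine ⟨N' * Gᵀ, ?_⟩
      funext i
      have e := mul_transpose_row (N' * Gᵀ) B i
      rw [mul_transpose_row N' G, (h.mulVec_left_inv (hL i)).2] at e
      exact e.symm
    obtain ⟨hli, hspan⟩ := (h.isBasis_iff N).1 ⟨hli, hspan⟩
    have hN := mulVec_row_eq_zero hspan
    have h2 := hmin.1.row_ne_zero
    have h1 := fun i ↦ (ne_iff N i).1 (h2 i)
    have e : δ = fun i ↦ rowDegree N i + s :=
      funext fun i ↦ by rw [← hdeg, hs.rowDegree_eq hN (h1 i) (h2 i)]
    refine ⟨rowDegree N, ⟨fun i j hij ↦ ?_, N, (hs.isMinimalBasis_iff h.left_inv hN h1 h2).1 hmin,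
      hli, hspan, fun _ ↦ rfl⟩, e⟩
    have := hmono hij
    simp only [e] at this
    omega
  · rintro ⟨ε, ⟨hmono, N, hmin, hli, hspan, hdeg⟩, rfl⟩
    have hN := mulVec_row_eq_zero hspan
    have h1 := hmin.1.row_ne_zero
    have h2 := fun i ↦ (ne_iff N i).2 (h1 i)
    obtain ⟨hli, hspan⟩ := (h.isBasis_iff N).2 ⟨hli, hspan⟩
    exact ⟨fun i j hij ↦ Nat.add_le_add_right (hmono hij) s, N * Bᵀ,
      (hs.isMinimalBasis_iff h.left_inv hN h1 h2).2 hmin, hli, hspan,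
      fun i ↦ by rw [hs.rowDegree_eq hN (h1 i) (h2 i), hdeg]⟩

end Transfer

end MatPoly

/-! ### Degree control by noncancelling leading coefficients. -/

namespace MatPoly

open Matrix

variable {F : Type*} [Field F]

theorem degree_mulVec_lt {m n : Type*} [Fintype n] {K : Matrix m n F[X]} {k D : ℕ}
    (hK : HasGrade k K) {v : n → F[X]} (hv : ∀ j, (v j).degree < D) (i : m) :
    ((K *ᵥ v) i).degree < (D + k : ℕ) := by
  rw [← mem_degreeLT]
  refine Submodule.sum_mem _ fun j _ ↦ mem_degreeLT.2 ?_
  by_cases h0 : v j = 0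
  · rw [h0, mul_zero, degree_zero]
    exact WithBot.bot_lt_coe _
  · have h1 := (natDegree_lt_iff_degree_lt h0).2 (hv j)
    refine degree_le_natDegree.trans_lt (Nat.cast_lt.2 ?_)
    have h2 := natDegree_mul_le (p := K i j) (q := v j)
    have h3 := hK i j
    change (K i j * v j).natDegree < D + k
    omega

/-- `K` has grade `ℓ`, and the columns `τ i` of its coefficient of `λ^ℓ` form an invertible
diagonal matrix. -/
structure HasPeaks {γ α : Type*} (K : Matrix γ α F[X]) (ℓ : ℕ) (τ : γ → α) : Prop where
  hasGrade : HasGrade ℓ K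
  coeff_ne : ∀ i, (K i (τ i)).coeff ℓ ≠ 0
  coeff_eq : ∀ i i', i' ≠ i → (K i' (τ i)).coeff ℓ = 0

namespace HasPeaks

theorem rowDegree_eq {γ α : Type*} [Fintype α] {K : Matrix γ α F[X]} {ℓ : ℕ} {τ : γ → α}
    (h : HasPeaks K ℓ τ) (i : γ) : rowDegree K i = ℓ :=
  le_antisymm (Finset.sup_le fun j _ ↦ h.hasGrade i j)
    ((le_natDegree_of_ne_zero (h.coeff_ne i)).trans (natDegree_le_rowDegree K i (τ i)))

theorem isRowReduced {γ α : Type*} [Fintype γ] [Fintype α] {K : Matrix γ α F[X]} {ℓ : ℕ}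
    {τ : γ → α} (h : HasPeaks K ℓ τ) : IsRowReduced K := by
  rw [IsRowReduced, rank_eq_card_iff]
  intro c hc
  ext1 i
  have := congrFun hc (τ i)
  simp only [vecMul, dotProduct, highestRowCoeff, of_apply, h.rowDegree_eq] at this
  rw [Finset.sum_eq_single i (fun i' _ hi' ↦ by rw [h.coeff_eq i i' hi', mul_zero])
    (by simp)] at this
  exact (mul_eq_zero.1 this).resolve_right (h.coeff_ne i)

theorem isMinimalBasis {γ α : Type*} [Fintype γ] [DecidableEq γ] [Fintype α]
    {K : Matrix γ α F[X]} {ℓ : ℕ} {τ : γ → α} (h : HasPeaks K ℓ τ) {R : Matrix α γ F[X]}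
    (hR : K * R = 1) : IsMinimalBasis K := by
  refine ⟨h.isRowReduced, fun x ↦ ?_⟩
  let f : F[X] →+* AlgebraicClosure F := (aeval x : F[X] →ₐ[F] AlgebraicClosure F).toRingHom
  change (K.map f).rank = _
  refine le_antisymm (rank_le_card_height _) ?_
  calc Fintype.card γ = (K.map f * R.map f).rank := by
        rw [← Matrix.map_mul, hR, Matrix.map_one _ f.map_zero f.map_one, rank_one]
    _ ≤ _ := rank_mul_le_left _ _

/-- Take `i₀` with `y i₀` of maximal degree. In coordinate `τ i₀` of `Kᵀ y`, the only contribution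
in degree `ℓ + deg (y i₀)` is that of `y i₀`, so nothing cancels. -/
theorem degree_lt {γ α : Type*} [Fintype γ] {K : Matrix γ α F[X]} {ℓ : ℕ}
    {τ : γ → α} (h : HasPeaks K ℓ τ) {y : γ → F[X]} {D : ℕ}
    (hy : ∀ j, ((Kᵀ *ᵥ y) j).degree < (D + ℓ : ℕ)) (i : γ) : (y i).degree < D := by
  by_contra hi
  obtain ⟨i₀, -, hmax⟩ := Finset.exists_max_image Finset.univ (fun i ↦ (y i).degree)
    ⟨i, Finset.mem_univ i⟩
  have hD := (not_lt.1 hi).trans (hmax i (Finset.mem_univ i))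
  have hD' : D ≤ (y i₀).natDegree := le_natDegree_of_coe_le_degree hD
  have h0 : y i₀ ≠ 0 := by
    intro h0
    simp [h0] at hD
  have key : ((Kᵀ *ᵥ y) (τ i₀)).coeff (ℓ + (y i₀).natDegree)
      = (K i₀ (τ i₀)).coeff ℓ * (y i₀).leadingCoeff := by
    simp only [mulVec, dotProduct, finsetSum_coeff, transpose_apply]
    rw [Finset.sum_eq_single i₀ _ (by simp)]
    · exact coeff_mul_add_eq_of_natDegree_le (h.hasGrade _ _) le_rfl
    · intro i' _ hi'
      rw [coeff_mul_add_eq_of_natDegree_le (h.hasGrade _ _) 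
          (natDegree_le_natDegree (hmax i' (Finset.mem_univ i'))),
        h.coeff_eq i₀ i' hi', zero_mul]
  rw [(degree_lt_iff_coeff_zero _ _).1 (hy (τ i₀)) _ (by omega)] at key
  exact mul_ne_zero (h.coeff_ne i₀) (leadingCoeff_ne_zero.2 h0) key.symm

theorem kronecker {γ α ν : Type*} [DecidableEq ν] {K : Matrix γ α F[X]} {ℓ : ℕ} {τ : γ → α}
    (h : HasPeaks K ℓ τ) :
    HasPeaks (K ⊗ₖ (1 : Matrix ν ν F[X])) ℓ (Prod.map τ id) := by
  refine ⟨fun ⟨i, a⟩ ⟨j, b⟩ ↦ ?_, fun ⟨i, a⟩ ↦ ?_, fun ⟨i, a⟩ ⟨i', a'⟩ hne ↦ ?_⟩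
  · by_cases hab : a = b <;> simp [one_apply, hab, h.hasGrade i j]
  · simpa using h.coeff_ne i
  · by_cases hab : a' = a
    · have : i' ≠ i := fun hi ↦ hne (by rw [hi, hab])
      simpa [hab] using h.coeff_eq i i' this
    · simp [one_apply, hab]

theorem submatrix {γ γ' α : Type*} {K : Matrix γ α F[X]} {ℓ : ℕ} {τ : γ → α}
    (h : HasPeaks K ℓ τ) {f : γ' → γ} (hf : Function.Injective f) :
    HasPeaks (K.submatrix f id) ℓ (τ ∘ f) :=
  ⟨fun i j ↦ h.hasGrade (f i) j, fun i ↦ h.coeff_ne (f i),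
    fun i i' hi ↦ h.coeff_eq (f i) (f i') (hf.ne hi)⟩

theorem smul {γ α : Type*} {K : Matrix γ α F[X]} {ℓ : ℕ} {τ : γ → α}
    (h : HasPeaks K ℓ τ) {a : F} (ha : a ≠ 0) : HasPeaks (C a • K) ℓ τ := by
  refine ⟨fun i j ↦ ?_, fun i ↦ ?_, fun i i' hi ↦ ?_⟩
  · exact (natDegree_C_mul_le _ _).trans (h.hasGrade i j)
  · simpa [coeff_C_mul, ha] using h.coeff_ne i
  · simp [coeff_C_mul, h.coeff_eq i i' hi]

end HasPeaks

section Block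

variable {α α' β γ δ : Type*} [Fintype α] [Fintype α'] [Fintype β] [Fintype γ]
  [Fintype δ] [DecidableEq α] [DecidableEq α'] [DecidableEq β] [DecidableEq γ] [DecidableEq δ]
  {K₁ : Matrix γ α F[X]} {N₁ Y₁ : Matrix β α F[X]} {R₁ : Matrix α γ F[X]}
  {K₂ : Matrix δ α' F[X]} {N₂ Y₂ : Matrix β α' F[X]} {R₂ : Matrix α' δ F[X]}
  {M : Matrix α' α F[X]} {P : Matrix β β F[X]}

theorem IsSplitBlock.shiftsDegree (h : IsSplitBlock K₁ N₁ Y₁ R₁ K₂ N₂ Y₂ R₂ M P) {ℓ s : ℕ}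
    (hM : HasGrade ℓ M) {τ : δ → α'} (hK : HasPeaks K₂ ℓ τ) {τ' : β → α}
    (hN : HasPeaks N₁ s τ') :
    ShiftsDegree P (fromRows N₁ᵀ (-(R₂ᵀ * M * N₁ᵀ))) s := by
  intro w hw D
  have h0 := h.isKernelTransfer.mulVec_eq_zero hw
  rw [fromRows_mulVec] at h0 ⊢
  rw [fromBlocks_mulVec] at h0
  -- The formula for the lower component suggests too large a degree, because of `R₂`. Only the
  -- equation `K₂ᵀ y = -M (N₁ᵀ w)` matters: `M` adds at most `ℓ` to the degree, and `K₂ᵀ` adds `ℓ`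
  -- without cancellation.
  generalize (-(R₂ᵀ * M * N₁ᵀ)) *ᵥ w = y at *
  have e : K₂ᵀ *ᵥ y = -(M *ᵥ (N₁ᵀ *ᵥ w)) := by
    ext1 j
    have := congrFun h0 (Sum.inl j)
    simp only [Sum.elim_inl, Sum.elim_comp_inl, Sum.elim_comp_inr, Pi.add_apply,
      Pi.zero_apply] at this
    rw [Pi.neg_apply, eq_neg_iff_add_eq_zero, add_comm, this]
  constructor
  · intro hw
    have hz : ∀ j, ((N₁ᵀ *ᵥ w) j).degree < (D + s : ℕ) :=
      degree_mulVec_lt (fun i j ↦ hN.hasGrade j i) hw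
    have hy : ∀ j, (y j).degree < (D + s : ℕ) := by
      refine hK.degree_lt fun j ↦ ?_
      rw [e, Pi.neg_apply, degree_neg]
      exact degree_mulVec_lt hM hz j
    rintro (j | j)
    · exact hz j
    · exact hy j
  · exact fun hj ↦ hN.degree_lt fun j ↦ hj (Sum.inl j)

theorem IsSplitBlock.areRightMinimalIndices_iff
    (h : IsSplitBlock K₁ N₁ Y₁ R₁ K₂ N₂ Y₂ R₂ M P) {ℓ s : ℕ}
    (hM : HasGrade ℓ M) {τ : δ → α'} (hK : HasPeaks K₂ ℓ τ) {τ' : β → α}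
    (hN : HasPeaks N₁ s τ') (p : ℕ) (ε' : Fin p → ℕ) :
    AreRightMinimalIndices (fromBlocks M K₂ᵀ K₁ 0) ε' ↔
      ∃ ε : Fin p → ℕ, AreRightMinimalIndices P ε ∧ ε' = fun i ↦ ε i + s :=
  h.isKernelTransfer.areRightMinimalIndices_iff (h.shiftsDegree hM hK hN) p ε'

theorem isUnimodular_of_mul_eq_one {m : Type*} [Fintype m] [DecidableEq m]
    {U U' : Matrix m m F[X]} (h : U * U' = 1) : IsUnimodular U := by
  have : IsUnit U.det := IsUnit.of_mul_eq_one U'.det (by rw [← det_mul, h, det_one])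
  obtain ⟨c, hc, e⟩ := Polynomial.isUnit_iff.1 this
  exact ⟨c, hc.ne_zero, e.symm⟩

theorem IsSplitBlock.isLification {K₁ : Matrix γ α F[X]} {R₁ : Matrix α γ F[X]}
    {K₂ : Matrix γ α F[X]} {R₂ : Matrix α γ F[X]} {N₁ Y₁ N₂ Y₂ : Matrix β α F[X]}
    {M : Matrix α α F[X]}
    (h : IsSplitBlock K₁ N₁ Y₁ R₁ K₂ N₂ Y₂ R₂ M P) {ℓ : ℕ}
    (hc : Fintype.card γ + Fintype.card β = Fintype.card α)
    (hL : HasGrade ℓ (fromBlocks M K₂ᵀ K₁ 0)) :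
    IsLification ℓ (fromBlocks M K₂ᵀ K₁ 0) P := by
  obtain ⟨U, U', V, V', hU, hV, e⟩ := h.exists_equivalence
  let f : (γ ⊕ γ) ⊕ β ≃ Fin (Fintype.card (γ ⊕ γ)) ⊕ β :=
    (Fintype.equivFin _).sumCongr (Equiv.refl β)
  -- Any bijection will do: the same one relabels the rows and columns of the block matrix, and `U`,
  -- `V` absorb it while remaining invertible.
  have g : α ⊕ γ ≃ (γ ⊕ γ) ⊕ β := Fintype.equivOfCardEq (by simp; omega)
  refine ⟨hL, Fintype.card (γ ⊕ γ), g.trans f, U.submatrix f.symm (g.trans f).symm,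
    V.submatrix (g.trans f).symm f.symm,
    isUnimodular_of_mul_eq_one (U' := U'.submatrix (g.trans f).symm f.symm) ?_,
    isUnimodular_of_mul_eq_one (U' := V'.submatrix f.symm (g.trans f).symm) (mul_eq_one_comm.1 ?_),
    ?_⟩
  · rw [submatrix_mul_equiv, hU, submatrix_one_equiv]
  · rw [submatrix_mul_equiv, hV, submatrix_one_equiv]
  · rw [reindex_apply, submatrix_mul_equiv, submatrix_mul_equiv, e]
    ext (i | i) (j | j) <;> simp [f, one_apply]

end Block

end MatPoly

/-! ### Homogeneous Kronecker blocks, their kernels and splittings. -/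

namespace MatPoly

open Matrix

variable {F : Type*} [Field F]

/-- The `d × (d+1)` matrix with `-u` on the diagonal and `w` on the superdiagonal. -/
noncomputable def homKronecker (d : ℕ) (u w : F[X]) : Matrix (Fin d) (Fin (d + 1)) F[X] :=
  Matrix.of fun i j => if j = i.castSucc then -u else if j = i.succ then w else 0

/-- The row vector with entries `u^j w^(d-j)`, which spans the kernel of `homKronecker d u w`. -/
noncomputable def homKernel (d : ℕ) (u w : F[X]) : Matrix Unit (Fin (d + 1)) F[X] :=
  Matrix.of fun _ j => u ^ (j : ℕ) * w ^ (d - (j : ℕ))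

/-- `homKernel d u w ⊗ I_n`, with rows indexed by `Fin n`. -/
noncomputable def kernelRows (d n : ℕ) (u w : F[X]) : Matrix (Fin n) (Fin (d + 1) × Fin n) F[X] :=
  (homKernel d u w ⊗ₖ (1 : Matrix (Fin n) (Fin n) F[X])).submatrix
    (Equiv.punitProd (Fin n)).symm id

theorem homKronecker_mul {β : Type*} (d : ℕ) (u w : F[X]) (B : Matrix (Fin (d + 1)) β F[X])
    (i : Fin d) (b : β) :
    (homKronecker d u w * B) i b = -u * B i.castSucc b + w * B i.succ b := by
  have e : ∀ j, homKronecker d u w i j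
      = (if j = i.castSucc then -u else 0) + (if j = i.succ then w else 0) := by
    intro j
    simp only [homKronecker, of_apply]
    by_cases h : j = i.castSucc
    · simp [h, Fin.castSucc_lt_succ.ne]
    · simp [h]
  simp [mul_apply, e, add_mul, Finset.sum_add_distrib]

theorem homKronecker_mul_homKernel (d : ℕ) (u w : F[X]) :
    homKronecker d u w * (homKernel d u w)ᵀ = 0 := by
  ext1 i b
  rw [homKronecker_mul]
  simp only [homKernel, transpose_apply, of_apply, Fin.val_castSucc, Fin.val_succ, Matrix.zero_apply]
  obtain ⟨k, hk⟩ : ∃ k, d = i + 1 + k := Nat.exists_eq_add_of_le i.2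
  have e1 : d - (i : ℕ) = k + 1 := by omega
  have e2 : d - ((i : ℕ) + 1) = k := by omega
  rw [e1, e2]
  ring

theorem exists_isSplitting_one (d : ℕ) (w : F[X]) :
    ∃ Y R, IsSplitting (homKronecker d 1 w) (homKernel d 1 w) Y R := by
  -- With `u = 1` the last kernel entry is `1`, and the columns of `R` come from back substitution
  -- starting at last coordinate `0`.
  refine ⟨of fun _ j ↦ if j = Fin.last d then 1 else 0,
    of fun i k ↦ if i ≤ k.castSucc then -w ^ ((k : ℕ) - (i : ℕ)) else 0,
    .of_card (by simp) ?_ (homKronecker_mul_homKernel d 1 w) ?_ ?_⟩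
  · ext1 i k
    rw [homKronecker_mul]
    simp only [of_apply, Fin.le_def, Fin.val_castSucc, Fin.val_succ, one_apply, Fin.ext_iff]
    rcases lt_trichotomy (i : ℕ) k with h | h | h
    · have e : (k : ℕ) - i = (k - (i + 1)) + 1 := by omega
      rw [if_pos h.le, if_pos (Nat.succ_le_of_lt h), if_neg h.ne, e]
      ring
    · rw [if_pos h.le, if_neg (by omega), if_pos h, h]
      simp
    · rw [if_neg (by omega), if_neg (by omega), if_neg h.ne']
      simp
  · ext1 i k
    rw [mul_apply]
    refine Finset.sum_eq_zero fun j _ ↦ ?_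
    by_cases hj : j = Fin.last d
    · simp [hj, Fin.le_def]
    · simp [hj]
  · ext1 i k
    simp [mul_apply, homKernel]

theorem exists_isSplitting_unit (d : ℕ) (u : F[X]) {c : F[X]} (hc : c * c = 1) :
    ∃ Y R, IsSplitting (homKronecker d u c) (homKernel d u c) Y R := by
  -- Now the first kernel entry `c^d` is its own inverse, and `R` comes from forward substitution
  -- starting at first coordinate `0`, with `c⁻¹ = c`.
  refine ⟨of fun _ j ↦ if j = 0 then c ^ d else 0,
    of fun j k ↦ if k.castSucc < j then c ^ ((j : ℕ) - k) * u ^ ((j : ℕ) - 1 - k) else 0,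
    .of_card (by simp) ?_ (homKronecker_mul_homKernel d u c) ?_ ?_⟩
  · ext1 i k
    rw [homKronecker_mul]
    simp only [of_apply, Fin.lt_def, Fin.val_castSucc, Fin.val_succ, one_apply, Fin.ext_iff]
    rcases lt_trichotomy (i : ℕ) k with h | h | h
    · rw [if_neg (by omega), if_neg (by omega), if_neg h.ne]
      simp
    · rw [if_neg (by omega), if_pos (by omega), if_pos h, h]
      simp [hc]
    · obtain ⟨m, hm⟩ : ∃ m, (i : ℕ) = k + 1 + m := Nat.exists_eq_add_of_le h
      rw [if_pos h, if_pos (by omega), if_neg h.ne', show (i : ℕ) - k = m + 1 by omega,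
        show (i : ℕ) - 1 - k = m by omega, show (i : ℕ) + 1 - k = m + 2 by omega,
        show (i : ℕ) + 1 - 1 - k = m + 1 by omega]
      linear_combination (c ^ (m + 1) * u ^ (m + 1)) * hc
  · ext1 i k
    rw [mul_apply]
    refine Finset.sum_eq_zero fun j _ ↦ ?_
    by_cases hj : j = 0 <;> simp [hj]
  · ext1 i k
    simp [mul_apply, homKernel, ← mul_pow, hc]

/-- The two pairs `(u, w)` for which `homKronecker d u w` occurs in `bigL` and its reversal. -/
def IsPowPair (ℓ : ℕ) (c : F) (u w : F[X]) : Prop :=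
  (u = 1 ∧ w = C c * X ^ ℓ) ∨ (u = X ^ ℓ ∧ w = C c)

namespace IsPowPair

variable {ℓ : ℕ} {c : F} {u w : F[X]}

theorem reflect (h : IsPowPair ℓ c u w) :
    IsPowPair ℓ c (Polynomial.reflect ℓ u) (Polynomial.reflect ℓ w) := by
  rcases h with ⟨rfl, rfl⟩ | ⟨rfl, rfl⟩
  · right
    simp [revAt_le]
  · left
    simp [reflect_C, reflect_monomial, revAt_le]

theorem natDegree_le (h : IsPowPair ℓ c u w) : u.natDegree ≤ ℓ ∧ w.natDegree ≤ ℓ := by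
  rcases h with ⟨rfl, rfl⟩ | ⟨rfl, rfl⟩
  · exact ⟨by simp, natDegree_C_mul_X_pow_le _ _⟩
  · simp

theorem exists_isSplitting (h : IsPowPair ℓ c u w) (hc : c * c = 1) (d n : ℕ) {a : F}
    (ha : a ≠ 0) : ∃ Y R,
      IsSplitting ((C a • homKronecker d u w) ⊗ₖ (1 : Matrix (Fin n) (Fin n) F[X]))
        (kernelRows d n u w) Y R := by
  have : ∃ Y R, IsSplitting (homKronecker d u w) (homKernel d u w) Y R := by
    rcases h with ⟨rfl, rfl⟩ | ⟨rfl, rfl⟩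
    · exact exists_isSplitting_one d _
    · exact exists_isSplitting_unit d _ (by rw [← C_mul, hc, C_1])
  obtain ⟨Y, R, hYR⟩ := this
  exact ⟨_, _, (hYR.smul (a := C a) (b := C a⁻¹)
    (by rw [← C_mul, mul_inv_cancel₀ ha, C_1])).kronecker⟩

/-- The coefficient of `λ^ℓ` lives on a single diagonal, the upper or the main one according to the
pair, because `ℓ ≥ 1` keeps the constant entries out. -/
theorem exists_hasPeaks_homKronecker (h : IsPowPair ℓ c u w) (hℓ : 1 ≤ ℓ) (hc : c ≠ 0) (d : ℕ) :
    ∃ τ, HasPeaks (homKronecker d u w) ℓ τ := by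
  have hg : HasGrade ℓ (homKronecker d u w) := by
    intro i j
    simp only [homKronecker, of_apply]
    split_ifs
    · simpa using h.natDegree_le.1
    · exact h.natDegree_le.2
    · simp
  have hℓ0 : ℓ ≠ 0 := by omega
  rcases h with ⟨rfl, rfl⟩ | ⟨rfl, rfl⟩
  · refine ⟨Fin.succ, hg, fun i ↦ ?_, fun i i' hi ↦ ?_⟩
    · simp [homKronecker, Fin.castSucc_lt_succ.ne', hc]
    · simp only [homKronecker, of_apply, Fin.succ_inj, hi.symm, if_false]
      split_ifs
      · simp [coeff_one, hℓ0]
      · simp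
  · refine ⟨Fin.castSucc, hg, fun i ↦ ?_, fun i i' hi ↦ ?_⟩
    · simp [homKronecker]
    · simp only [homKronecker, of_apply, Fin.castSucc_inj, hi.symm, if_false]
      split_ifs
      · simp [coeff_C, hℓ0]
      · simp

theorem natDegree_homKernel_le (h : IsPowPair ℓ c u w) (d : ℕ) (i : Unit) (j : Fin (d + 1)) :
    (homKernel d u w i j).natDegree ≤ d * ℓ := by
  have h1 := natDegree_pow_le_of_le (j : ℕ) h.natDegree_le.1
  have h2 := natDegree_pow_le_of_le (d - (j : ℕ)) h.natDegree_le.2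
  calc (homKernel d u w i j).natDegree ≤ (j : ℕ) * ℓ + (d - (j : ℕ)) * ℓ :=
        natDegree_mul_le_of_le h1 h2
    _ = d * ℓ := by rw [← Nat.add_mul]; congr 1; omega

theorem exists_hasPeaks_homKernel (h : IsPowPair ℓ c u w) (hc : c ≠ 0) (d : ℕ) :
    ∃ τ, HasPeaks (homKernel d u w) (d * ℓ) τ := by
  have hg : HasGrade (d * ℓ) (homKernel d u w) := h.natDegree_homKernel_le d
  rcases h with ⟨rfl, rfl⟩ | ⟨rfl, rfl⟩
  · refine ⟨fun _ ↦ 0, hg, fun i ↦ ?_, fun i i' hi ↦ absurd (Subsingleton.elim _ _) hi⟩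
    have e : homKernel d 1 (C c * X ^ ℓ) i 0 = C (c ^ d) * X ^ (d * ℓ) := by
      simp [homKernel, mul_pow, ← pow_mul, mul_comm ℓ d]
    rw [e, coeff_C_mul_X_pow, if_pos rfl]
    exact pow_ne_zero _ hc
  · refine ⟨fun _ ↦ Fin.last d, hg, fun i ↦ ?_, fun i i' hi ↦ absurd (Subsingleton.elim _ _) hi⟩
    simp [homKernel, ← pow_mul, mul_comm ℓ d]

theorem exists_hasPeaks_kronecker (h : IsPowPair ℓ c u w) (hℓ : 1 ≤ ℓ) (hc : c ≠ 0) (d n : ℕ)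
    {a : F} (ha : a ≠ 0) : ∃ τ,
      HasPeaks ((C a • homKronecker d u w) ⊗ₖ (1 : Matrix (Fin n) (Fin n) F[X])) ℓ τ := by
  obtain ⟨τ, hτ⟩ := h.exists_hasPeaks_homKronecker hℓ hc d
  exact ⟨_, (hτ.smul ha).kronecker⟩

theorem exists_hasPeaks_kernelRows (h : IsPowPair ℓ c u w) (hc : c ≠ 0) (d n : ℕ) :
    ∃ τ, HasPeaks (kernelRows d n u w) (d * ℓ) τ := by
  obtain ⟨τ, hτ⟩ := h.exists_hasPeaks_homKernel hc d
  exact ⟨_, hτ.kronecker.submatrix (Equiv.injective _)⟩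

end IsPowPair

theorem kernelRows_mul_mul_apply {d n : ℕ} (u w u' w' : F[X])
    (M : Matrix (Fin (d + 1) × Fin n) (Fin (d + 1) × Fin n) F[X]) (a b : Fin n) :
    (kernelRows d n u w * M * (kernelRows d n u' w')ᵀ) a b
      = ∑ s, ∑ t, homKernel d u w () s * homKernel d u' w' () t * M (s, a) (t, b) := by
  simp only [kernelRows, mul_apply, submatrix_apply, transpose_apply, kroneckerMap_apply,
    Fintype.sum_prod_type, one_apply, Equiv.punitProd_symm_apply, id, mul_ite, mul_one, mul_zero,
    ite_mul, zero_mul, Finset.sum_ite_eq, Finset.mem_univ, if_true, Finset.sum_mul]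
  rw [Finset.sum_comm]
  exact Finset.sum_congr rfl fun _ _ ↦ Finset.sum_congr rfl fun _ _ ↦ by ring

/-! ### Reversal -/

theorem reflect_sum {ι : Type*} (s : Finset ι) (f : ι → F[X]) (N : ℕ) :
    Polynomial.reflect N (∑ i ∈ s, f i) = ∑ i ∈ s, Polynomial.reflect N (f i) := by
  ext j
  simp [coeff_reflect]

theorem reflect_pow {p : F[X]} {N : ℕ} (hp : p.natDegree ≤ N) (m : ℕ) :
    Polynomial.reflect (m * N) (p ^ m) = Polynomial.reflect N p ^ m := by
  induction m with
  | zero => simp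
  | succ m ih =>
    rw [pow_succ, pow_succ, Nat.succ_mul, reflect_mul _ _ (natDegree_pow_le_of_le m hp) hp, ih]

theorem IsPowPair.reflect_homKernel {ℓ : ℕ} {c : F} {u w : F[X]} (h : IsPowPair ℓ c u w) (d : ℕ)
    (i : Unit) (j : Fin (d + 1)) :
    Polynomial.reflect (d * ℓ) (homKernel d u w i j)
      = homKernel d (Polynomial.reflect ℓ u) (Polynomial.reflect ℓ w) i j := by
  have e : d * ℓ = (j : ℕ) * ℓ + (d - (j : ℕ)) * ℓ := by
    rw [← Nat.add_mul]; congr 1; omega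
  simp only [homKernel, of_apply]
  rw [e, reflect_mul _ _ (natDegree_pow_le_of_le _ h.natDegree_le.1)
    (natDegree_pow_le_of_le _ h.natDegree_le.2), reflect_pow h.natDegree_le.1,
    reflect_pow h.natDegree_le.2]

/-- Reversal is multiplicative when grades add, and here `k = dℓ + ℓ + dℓ`. -/
theorem rev_kernelRows_mul_mul {d n ℓ k : ℕ} {c c' : F} {u w u' w' : F[X]}
    (h : IsPowPair ℓ c u w) (h' : IsPowPair ℓ c' u' w') (hk : k = (2 * d + 1) * ℓ)
    {M : Matrix (Fin (d + 1) × Fin n) (Fin (d + 1) × Fin n) F[X]} (hM : HasGrade ℓ M) :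
    rev k (kernelRows d n u w * M * (kernelRows d n u' w')ᵀ)
      = kernelRows d n (Polynomial.reflect ℓ u) (Polynomial.reflect ℓ w) * rev ℓ M
        * (kernelRows d n (Polynomial.reflect ℓ u') (Polynomial.reflect ℓ w'))ᵀ := by
  ext1 a b
  rw [kernelRows_mul_mul_apply, rev, map_apply, kernelRows_mul_mul_apply, reflect_sum]
  refine Finset.sum_congr rfl fun s _ ↦ ?_
  rw [reflect_sum]
  refine Finset.sum_congr rfl fun t _ ↦ ?_
  have hs := h.natDegree_homKernel_le d () s
  have ht := h'.natDegree_homKernel_le d () t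
  rw [show k = (d * ℓ + d * ℓ) + ℓ by rw [hk]; ring,
    reflect_mul _ _ (natDegree_mul_le_of_le hs ht) (hM _ _), reflect_mul _ _ hs ht,
    h.reflect_homKernel, h'.reflect_homKernel]
  rfl

theorem rev_smul_homKronecker (d ℓ : ℕ) (a : F) (u w : F[X]) :
    rev ℓ (C a • homKronecker d u w)
      = C a • homKronecker d (Polynomial.reflect ℓ u) (Polynomial.reflect ℓ w) := by
  ext1 i j
  simp only [rev, map_apply, Matrix.smul_apply, smul_eq_mul, reflect_C_mul, homKronecker, of_apply]
  split_ifs <;> simp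

theorem rev_kronecker_one {m n ν : Type*} [DecidableEq ν] (ℓ : ℕ) (K : Matrix m n F[X]) :
    rev ℓ (K ⊗ₖ (1 : Matrix ν ν F[X])) = rev ℓ K ⊗ₖ (1 : Matrix ν ν F[X]) := by
  ext1 ⟨i, a⟩ ⟨j, b⟩
  by_cases hab : a = b <;> simp [rev, one_apply, hab]

theorem rev_fromBlocks {α β γ δ : Type*} (ℓ : ℕ) (A : Matrix α β F[X]) (B : Matrix α δ F[X])
    (D : Matrix γ β F[X]) :
    rev ℓ (fromBlocks A B D (0 : Matrix γ δ F[X]))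
      = fromBlocks (rev ℓ A) (rev ℓ B) (rev ℓ D) 0 := by
  rw [rev, fromBlocks_map, Matrix.map_zero _ reflect_zero]
  rfl

theorem hasGrade_rev {m n : Type*} {ℓ : ℕ} {K : Matrix m n F[X]} (h : HasGrade ℓ K) :
    HasGrade ℓ (rev ℓ K) := fun i j ↦
  natDegree_reflect_le.trans (max_le le_rfl (h i j))

end MatPoly

namespace MatPoly

open Matrix

variable {F : Type*} [Field F]

/-! ### The outer blocks of `bigL` -/

theorem mobius_apply {m n : Type*} (A : Matrix (Fin 2) (Fin 2) F) (k : ℕ) (P : Matrix m n F[X])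
    (i : m) (j : n) : mobius A k P i j = ∑ r ∈ Finset.range (k + 1),
      (C (A 0 0) * X + C (A 0 1)) ^ r * (C (A 1 0) * X + C (A 1 1)) ^ (k - r)
        * C ((P i j).coeff r) := by
  rw [mobius, Matrix.sum_apply]
  rfl

theorem smul_substPow_kroneckerPencil_apply (d ℓ : ℕ) (σ : ℤˣ) (i : Fin d) (j : Fin (d + 1)) :
    (σ • substPow ℓ (kroneckerPencil F d)) i j = C ((σ : ℤ) : F) *
      (if j = i.castSucc then -1 else if j = i.succ then X ^ ℓ else 0) := by
  have e : substPow ℓ (kroneckerPencil F d) i j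
      = if j = i.castSucc then -1 else if j = i.succ then X ^ ℓ else 0 := by
    simp only [substPow, kroneckerPencil, map_apply, of_apply]
    split_ifs <;> simp
  rcases Int.units_eq_one_or σ with rfl | rfl
  · simp [e]
  · rw [Units.neg_smul, one_smul, Matrix.neg_apply, e]
    simp only [Units.val_neg, Units.val_one, Int.cast_neg, Int.cast_one, C_neg, C_1, neg_one_mul]

/-- `L_d(λ^ℓ)` has coefficients only in degrees `0` and `ℓ`, so just the two extreme terms of the
Möbius sum survive. -/
theorem mobius_smul_substPow_kroneckerPencil (d : ℕ) {ℓ : ℕ} (hℓ : 1 ≤ ℓ)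
    (A : Matrix (Fin 2) (Fin 2) F) (σ : ℤˣ) :
    mobius A ℓ (σ • substPow ℓ (kroneckerPencil F d)) = C ((σ : ℤ) : F) •
      homKronecker d ((C (A 1 0) * X + C (A 1 1)) ^ ℓ) ((C (A 0 0) * X + C (A 0 1)) ^ ℓ) := by
  ext1 i j
  rw [mobius_apply, smul_substPow_kroneckerPencil_apply]
  simp only [Matrix.smul_apply, homKronecker, of_apply,
    coeff_C_mul]
  have hℓ0 : ℓ ≠ 0 := by omega
  split_ifs
  · rw [Finset.sum_eq_single 0]
    · rw [pow_zero, one_mul, Nat.sub_zero, coeff_neg, coeff_one_zero, C_mul, C_neg, C_1]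
      ring
    · intro r _ hr
      simp [coeff_one, hr]
    · simp
  · rw [Finset.sum_eq_single ℓ]
    · rw [Nat.sub_self, pow_zero, mul_one, coeff_X_pow_self, mul_one, mul_comm,
        smul_eq_mul]
    · intro r _ hr
      simp [coeff_X_pow, hr]
    · simp
  · simp

theorem bigL_eq {n d ℓ : ℕ} (hℓ : 1 ≤ ℓ) (A : Matrix (Fin 2) (Fin 2) F) (σ : ℤˣ)
    (M : Matrix (Fin (d + 1) × Fin n) (Fin (d + 1) × Fin n) F[X]) :
    bigL ℓ A σ M = fromBlocks M
      ((C ((σ : ℤ) : F) • homKronecker d ((C (A 1 0) * X + C (A 1 1)) ^ ℓ)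
        ((C (A 0 0) * X + C (A 0 1)) ^ ℓ)) ⊗ₖ (1 : Matrix (Fin n) (Fin n) F[X]))ᵀ
      ((C (1 : F) • homKronecker d 1 (C (1 : F) * X ^ ℓ)) ⊗ₖ (1 : Matrix (Fin n) (Fin n) F[X]))
      0 := by
  rw [bigL, mobius_smul_substPow_kroneckerPencil d hℓ, ← kroneckerMap_transpose, transpose_one]
  congr 2
  ext1 i j
  have := smul_substPow_kroneckerPencil_apply (F := F) d ℓ 1 i j
  rw [one_smul] at this
  rw [this]
  simp [homKronecker]

/-! ### The sum conditions -/

theorem antidiagSum_apply {n d : ℕ} (M : Matrix (Fin (d + 1) × Fin n) (Fin (d + 1) × Fin n) F[X])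
    (i w : ℕ) (a b : Fin n) : antidiagSum M i w a b = ∑ s : Fin (d + 1), ∑ t : Fin (d + 1),
      if ((s : ℕ) + 1) + ((t : ℕ) + 1) = w then (M (s, a) (t, b)).coeff i else 0 := by
  simp only [antidiagSum, Matrix.sum_apply]
  refine Finset.sum_congr rfl fun s _ ↦ Finset.sum_congr rfl fun t _ ↦ ?_
  split_ifs <;> rfl

theorem signedAntidiagSum_apply {n d : ℕ}
    (M : Matrix (Fin (d + 1) × Fin n) (Fin (d + 1) × Fin n) F[X]) (i w : ℕ) (a b : Fin n) :
    signedAntidiagSum M i w a b = ∑ s : Fin (d + 1), ∑ t : Fin (d + 1),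
      if ((s : ℕ) + 1) + ((t : ℕ) + 1) = w then
        (-1 : F) ^ (d - (s : ℕ)) * (M (s, a) (t, b)).coeff i else 0 := by
  simp only [signedAntidiagSum, Matrix.sum_apply]
  refine Finset.sum_congr rfl fun s _ ↦ Finset.sum_congr rfl fun t _ ↦ ?_
  split_ifs <;> rfl

theorem diagSum_apply {n d : ℕ} (M : Matrix (Fin (d + 1) × Fin n) (Fin (d + 1) × Fin n) F[X])
    (i : ℕ) (w : ℤ) (a b : Fin n) : diagSum M i w a b = ∑ s : Fin (d + 1), ∑ t : Fin (d + 1),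
      if ((s : ℕ) : ℤ) - ((t : ℕ) : ℤ) = w then (M (s, a) (t, b)).coeff i else 0 := by
  simp only [diagSum, Matrix.sum_apply]
  refine Finset.sum_congr rfl fun s _ ↦ Finset.sum_congr rfl fun t _ ↦ ?_
  split_ifs <;> rfl

/-- The coefficient of degree `ℓ` spills over into the constant place of the next window of length
`ℓ`. This is why the identities for `P_{ℓ r}` involve both `M_0` and `M_ℓ`, with shifted block
index. -/
theorem coeff_X_pow_mul_of_natDegree_le {f : F[X]} {ℓ c : ℕ} (hf : f.natDegree ≤ ℓ) (hc : c < ℓ)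
    (e r : ℕ) : (X ^ (ℓ * e) * f).coeff (ℓ * r + c)
      = (if e = r then f.coeff c else 0) + (if c = 0 ∧ e + 1 = r then f.coeff ℓ else 0) := by
  rw [coeff_X_pow_mul']
  rcases lt_trichotomy e r with h | rfl | h
  · obtain ⟨m, rfl⟩ : ∃ m, r = e + 1 + m := Nat.exists_eq_add_of_le h
    have e1 : ℓ * (e + 1 + m) + c - ℓ * e = ℓ + (ℓ * m + c) := by
      rw [Nat.mul_add, Nat.mul_add]; omega
    rw [if_pos (by rw [Nat.mul_add, Nat.mul_add]; omega), if_neg (by omega), zero_add, e1]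
    split_ifs with h1
    · obtain ⟨rfl, h1⟩ := h1
      obtain rfl : m = 0 := by omega
      simp
    · refine coeff_eq_zero_of_natDegree_lt (hf.trans_lt ?_)
      rcases Nat.eq_zero_or_pos m with rfl | hm
      · have : c ≠ 0 := fun h0 ↦ h1 ⟨h0, rfl⟩
        omega
      · have : 0 < ℓ * m := Nat.mul_pos (by omega) hm
        omega
  · simp
  · have : ℓ * (r + 1) ≤ ℓ * e := Nat.mul_le_mul_left _ h
    rw [Nat.mul_add] at this
    rw [if_neg (by omega), if_neg (by omega), if_neg (by omega), zero_add]

/-- Common form of the three sum conditions: block `(s, t)` of `M` enters the product with sign `ε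
s` and shift `λ^(ℓ e(s,t))`. -/
theorem eq_kernelRows_mul_mul {n d ℓ k : ℕ} (hℓ : 1 ≤ ℓ) (hk : k = (2 * d + 1) * ℓ)
    {P : Matrix (Fin n) (Fin n) F[X]} (hP : HasGrade k P)
    {M : Matrix (Fin (d + 1) × Fin n) (Fin (d + 1) × Fin n) F[X]} (hM : HasGrade ℓ M)
    {u w u' w' : F[X]} {ε : Fin (d + 1) → F} {e : Fin (d + 1) → Fin (d + 1) → ℕ}
    (he : ∀ s t, e s t ≤ 2 * d)
    (hker : ∀ s t, homKernel d u w () s * homKernel d u' w' () t = C (ε s) * X ^ (ℓ * e s t))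
    (h₀ : ∀ r ≤ 2 * d + 1, ∀ a b, (P a b).coeff (ℓ * r) =
      (∑ s, ∑ t, if e s t = r then ε s * (M (s, a) (t, b)).coeff 0 else 0)
        + ∑ s, ∑ t, if e s t + 1 = r then ε s * (M (s, a) (t, b)).coeff ℓ else 0)
    (h₁ : ∀ r ≤ 2 * d, ∀ c, 1 ≤ c → c < ℓ → ∀ a b, (P a b).coeff (ℓ * r + c) =
      ∑ s, ∑ t, if e s t = r then ε s * (M (s, a) (t, b)).coeff c else 0) :
    kernelRows d n u w * M * (kernelRows d n u' w')ᵀ = P := by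
  ext a b j
  rw [kernelRows_mul_mul_apply]
  simp only [hker, finsetSum_coeff, mul_assoc, coeff_C_mul]
  obtain ⟨r, c, hc, rfl⟩ : ∃ r c, c < ℓ ∧ j = ℓ * r + c :=
    ⟨j / ℓ, j % ℓ, Nat.mod_lt _ hℓ, (Nat.div_add_mod j ℓ).symm⟩
  simp only [coeff_X_pow_mul_of_natDegree_le (hM _ _) hc, mul_add, mul_ite, mul_zero]
  -- These are exactly the indices up to `k`; beyond them both sides vanish, by the grade of `P` and
  -- by `e ≤ 2d`.
  by_cases hr : r ≤ 2 * d ∨ r = 2 * d + 1 ∧ c = 0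
  · rcases Nat.eq_zero_or_pos c with rfl | hc0
    · rw [add_zero, h₀ r (by omega)]
      simp only [Finset.sum_add_distrib, true_and]
    · rw [h₁ r (by omega) c hc0 hc]
      simp only [hc0.ne', false_and, if_false, add_zero]
  · have hj : k < ℓ * r + c := by
      by_contra hcon
      have h1 : ℓ * r + c ≤ ℓ * (2 * d + 1) := by rw [mul_comm ℓ (2 * d + 1), ← hk]; omega
      have h2 : r ≤ 2 * d + 1 := Nat.le_of_mul_le_mul_left ((Nat.le_add_right _ c).trans h1) hℓ
      have h3 : r = 2 * d + 1 := by omega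
      rw [h3] at h1
      omega
    rw [coeff_eq_zero_of_natDegree_lt ((hP a b).trans_lt hj)]
    refine Finset.sum_eq_zero fun s _ ↦ Finset.sum_eq_zero fun t _ ↦ ?_
    have := he s t
    rw [if_neg (by omega), if_neg (by omega), add_zero]

/-- The exponent depends only on `s + t`, hence antidiagonals; with `c = -1` the factor `c^(d-s)` is
the sign in `ASS`. -/
theorem homKernel_mul_homKernel_antidiag {d ℓ : ℕ} (c : F) (s t : Fin (d + 1)) :
    homKernel d 1 (C c * X ^ ℓ) () s * homKernel d 1 (C 1 * X ^ ℓ) () t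
      = C (c ^ (d - (s : ℕ))) * X ^ (ℓ * ((d - (s : ℕ)) + (d - (t : ℕ)))) := by
  simp only [homKernel, of_apply, one_pow, one_mul, mul_pow, C_pow, ← pow_mul, C_1, mul_assoc,
    ← pow_add, Nat.mul_add]

/-- With the left pair reversed the exponent depends on `s - t`, hence diagonals. -/
theorem homKernel_mul_homKernel_diag {d ℓ : ℕ} (s t : Fin (d + 1)) :
    homKernel d (X ^ ℓ) (C (1 : F)) () s * homKernel d 1 (C 1 * X ^ ℓ) () t
      = C 1 * X ^ (ℓ * ((s : ℕ) + (d - (t : ℕ)))) := by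
  simp only [homKernel, of_apply, one_pow, one_mul, mul_one, C_1, ← pow_mul, ← pow_add,
    Nat.mul_add]

section SumConditions

variable {n d ℓ k : ℕ} {P : Matrix (Fin n) (Fin n) F[X]}
  {M : Matrix (Fin (d + 1) × Fin n) (Fin (d + 1) × Fin n) F[X]}

theorem AS.kernelRows_mul_mul (h : AS ℓ M P) (hℓ : 1 ≤ ℓ) (hk : k = (2 * d + 1) * ℓ)
    (hP : HasGrade k P) (hM : HasGrade ℓ M) :
    kernelRows d n 1 (C (1 : F) * X ^ ℓ) * M * (kernelRows d n 1 (C (1 : F) * X ^ ℓ))ᵀ = P := by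
  refine eq_kernelRows_mul_mul hℓ hk hP hM (fun s t ↦ by omega)
    (homKernel_mul_homKernel_antidiag 1) (fun r hr a b ↦ ?_) (fun r hr c hc hc' a b ↦ ?_)
  · refine (congrFun (congrFun (h.1 r hr) a) b).trans ?_
    rw [Matrix.add_apply, antidiagSum_apply, antidiagSum_apply]
    congr 1 <;> refine Finset.sum_congr rfl fun s _ ↦ Finset.sum_congr rfl fun t _ ↦ ?_ <;>
      rw [one_pow, one_mul] <;> exact if_congr (by omega) rfl rfl
  · refine (congrFun (congrFun (h.2 r hr c hc hc') a) b).trans ?_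
    rw [antidiagSum_apply]
    refine Finset.sum_congr rfl fun s _ ↦ Finset.sum_congr rfl fun t _ ↦ ?_
    rw [one_pow, one_mul]
    exact if_congr (by omega) rfl rfl

theorem ASS.kernelRows_mul_mul (h : ASS ℓ M P) (hℓ : 1 ≤ ℓ) (hk : k = (2 * d + 1) * ℓ)
    (hP : HasGrade k P) (hM : HasGrade ℓ M) :
    kernelRows d n 1 (C (-1 : F) * X ^ ℓ) * M * (kernelRows d n 1 (C (1 : F) * X ^ ℓ))ᵀ = P := by
  refine eq_kernelRows_mul_mul hℓ hk hP hM (fun s t ↦ by omega)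
    (homKernel_mul_homKernel_antidiag (-1)) (fun r hr a b ↦ ?_) (fun r hr c hc hc' a b ↦ ?_)
  · refine (congrFun (congrFun (h.1 r hr) a) b).trans ?_
    rw [Matrix.add_apply, signedAntidiagSum_apply, signedAntidiagSum_apply]
    congr 1 <;> exact Finset.sum_congr rfl fun s _ ↦ Finset.sum_congr rfl fun t _ ↦
      if_congr (by omega) rfl rfl
  · refine (congrFun (congrFun (h.2 r hr c hc hc') a) b).trans ?_
    rw [signedAntidiagSum_apply]
    exact Finset.sum_congr rfl fun s _ ↦ Finset.sum_congr rfl fun t _ ↦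
      if_congr (by omega) rfl rfl

theorem DS.kernelRows_mul_mul (h : DS ℓ M P) (hℓ : 1 ≤ ℓ) (hk : k = (2 * d + 1) * ℓ)
    (hP : HasGrade k P) (hM : HasGrade ℓ M) :
    kernelRows d n (X ^ ℓ) (C (1 : F)) * M * (kernelRows d n 1 (C (1 : F) * X ^ ℓ))ᵀ = P := by
  refine eq_kernelRows_mul_mul (ε := fun _ ↦ 1) hℓ hk hP hM (fun s t ↦ by omega)
    homKernel_mul_homKernel_diag (fun r hr a b ↦ ?_) (fun r hr c hc hc' a b ↦ ?_)
  · refine (congrFun (congrFun (h.1 r hr) a) b).trans ?_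
    rw [Matrix.add_apply, diagSum_apply, diagSum_apply]
    congr 1 <;> refine Finset.sum_congr rfl fun s _ ↦ Finset.sum_congr rfl fun t _ ↦ ?_ <;>
      rw [one_mul] <;> exact if_congr (by omega) rfl rfl
  · refine (congrFun (congrFun (h.2 r hr c hc hc') a) b).trans ?_
    rw [diagSum_apply]
    refine Finset.sum_congr rfl fun s _ ↦ Finset.sum_congr rfl fun t _ ↦ ?_
    rw [one_mul]
    exact if_congr (by omega) rfl rfl

/-! ### Strong block minimal bases, strong `ℓ`-ification, minimal indices -/

theorem hasGrade_fromBlocks {α β γ δ : Type*} {A : Matrix α β F[X]} {B : Matrix δ α F[X]}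
    {D : Matrix γ β F[X]} (hA : HasGrade ℓ A) (hB : HasGrade ℓ B) (hD : HasGrade ℓ D) :
    HasGrade ℓ (fromBlocks A Bᵀ D 0) := by
  rintro (i | i) (j | j)
  · exact hA i j
  · exact hB j i
  · exact hD i j
  · exact (natDegree_zero (R := F)).trans_le (Nat.zero_le _)

/-- The dual is `kernelRows`, with all row degrees `d ℓ`. The splitting gives polynomial right
inverses of both matrices, hence full rank at every point. -/
theorem IsPowPair.hasDualWithEqualRowDegrees {c : F} {u w : F[X]} (h : IsPowPair ℓ c u w)
    (hℓ : 1 ≤ ℓ) (hc : c * c = 1) (d n : ℕ) {a : F} (ha : a ≠ 0) :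
    HasDualWithEqualRowDegrees
      ((C a • homKronecker d u w) ⊗ₖ (1 : Matrix (Fin n) (Fin n) F[X])) := by
  have hc0 : c ≠ 0 := left_ne_zero_of_mul_eq_one hc
  obtain ⟨Y, R, hs⟩ := h.exists_isSplitting hc d n ha
  obtain ⟨τ, hτ⟩ := h.exists_hasPeaks_kronecker hℓ hc0 d n ha
  obtain ⟨τ', hτ'⟩ := h.exists_hasPeaks_kernelRows hc0 d n
  refine ⟨n, kernelRows d n u w, ⟨hτ.isMinimalBasis hs.mul_right,
    hτ'.isMinimalBasis hs.dual_compl, ?_, hs.mul_dual⟩, fun i j ↦ ?_⟩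
  · simp only [Fintype.card_prod, Fintype.card_fin]
    ring
  · rw [hτ'.rowDegree_eq, hτ'.rowDegree_eq]

/-- The strong block minimal bases polynomial with outer blocks built from `homKronecker`. -/
noncomputable def kroneckerBlock {n d : ℕ} (a : F) (u w : F[X]) (u' w' : F[X])
    (M : Matrix (Fin (d + 1) × Fin n) (Fin (d + 1) × Fin n) F[X]) :
    Matrix ((Fin (d + 1) × Fin n) ⊕ (Fin d × Fin n))
      ((Fin (d + 1) × Fin n) ⊕ (Fin d × Fin n)) F[X] :=
  fromBlocks M ((C a • homKronecker d u w) ⊗ₖ (1 : Matrix (Fin n) (Fin n) F[X]))ᵀ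
    ((C (1 : F) • homKronecker d u' w') ⊗ₖ (1 : Matrix (Fin n) (Fin n) F[X])) 0

variable {a c c' : F} {u w u' w' : F[X]}

theorem isStrongBlockMinimalBases_kroneckerBlock (h : IsPowPair ℓ c u w)
    (h' : IsPowPair ℓ c' u' w') (hℓ : 1 ≤ ℓ) (hc : c * c = 1) (hc' : c' * c' = 1) (ha : a ≠ 0)
    (hM : HasGrade ℓ M) : IsStrongBlockMinimalBases ℓ (kroneckerBlock a u w u' w' M) := by
  obtain ⟨Y, R, hs⟩ := h.exists_isSplitting hc d n ha
  obtain ⟨Y', R', hs'⟩ := h'.exists_isSplitting hc' d n one_ne_zero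
  obtain ⟨τ, hτ⟩ := h.exists_hasPeaks_kronecker hℓ (left_ne_zero_of_mul_eq_one hc) d n ha
  obtain ⟨τ', hτ'⟩ :=
    h'.exists_hasPeaks_kronecker hℓ (left_ne_zero_of_mul_eq_one hc') d n one_ne_zero
  simp only [IsStrongBlockMinimalBases, IsBlockMinimalBases, kroneckerBlock,
    toBlocks_fromBlocks₁₂, toBlocks_fromBlocks₂₁, toBlocks_fromBlocks₂₂, transpose_transpose]
  exact ⟨⟨hasGrade_fromBlocks hM hτ.hasGrade hτ'.hasGrade, trivial,
    hτ'.isMinimalBasis hs'.mul_right, hτ.isMinimalBasis hs.mul_right⟩,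
    hτ'.rowDegree_eq, hτ.rowDegree_eq,
    h'.hasDualWithEqualRowDegrees hℓ hc' d n one_ne_zero,
    h.hasDualWithEqualRowDegrees hℓ hc d n ha⟩

theorem isLification_kroneckerBlock (h : IsPowPair ℓ c u w)
    (h' : IsPowPair ℓ c' u' w') (hℓ : 1 ≤ ℓ) (hc : c * c = 1) (hc' : c' * c' = 1) (ha : a ≠ 0)
    (hM : HasGrade ℓ M) (hP : kernelRows d n u w * M * (kernelRows d n u' w')ᵀ = P) :
    IsLification ℓ (kroneckerBlock a u w u' w' M) P := by
  obtain ⟨Y, R, hs⟩ := h.exists_isSplitting hc d n ha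
  obtain ⟨Y', R', hs'⟩ := h'.exists_isSplitting hc' d n one_ne_zero
  refine IsSplitBlock.isLification ⟨hs', hs, hP⟩ ?_
    (isStrongBlockMinimalBases_kroneckerBlock h h' hℓ hc hc' ha hM).1.1
  simp only [Fintype.card_prod, Fintype.card_fin]
  ring

theorem rev_kroneckerBlock : rev ℓ (kroneckerBlock a u w u' w' M)
    = kroneckerBlock a (reflect ℓ u) (reflect ℓ w) (reflect ℓ u') (reflect ℓ w') (rev ℓ M) := by
  have e : ∀ K : Matrix (Fin d × Fin n) (Fin (d + 1) × Fin n) F[X], rev ℓ Kᵀ = (rev ℓ K)ᵀ :=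
    fun _ ↦ rfl
  simp only [kroneckerBlock, rev_fromBlocks, e, rev_kronecker_one, rev_smul_homKronecker]

theorem isStrongLification_kroneckerBlock (h : IsPowPair ℓ c u w)
    (h' : IsPowPair ℓ c' u' w') (hℓ : 1 ≤ ℓ) (hk : k = (2 * d + 1) * ℓ) (hc : c * c = 1)
    (hc' : c' * c' = 1) (ha : a ≠ 0) (hPk : HasGrade k P)
    (hM : HasGrade ℓ M) (hP : kernelRows d n u w * M * (kernelRows d n u' w')ᵀ = P) :
    IsStrongLification ℓ k (kroneckerBlock a u w u' w' M) P := by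
  refine ⟨hPk, isLification_kroneckerBlock h h' hℓ hc hc' ha hM hP, ?_⟩
  rw [rev_kroneckerBlock]
  refine isLification_kroneckerBlock h.reflect h'.reflect hℓ hc hc' ha (hasGrade_rev hM) ?_
  rw [← hP, rev_kernelRows_mul_mul h h' hk hM]

theorem areRightMinimalIndices_kroneckerBlock (h : IsPowPair ℓ c u w)
    (h' : IsPowPair ℓ c' u' w') (hℓ : 1 ≤ ℓ) (hc : c * c = 1) (hc' : c' * c' = 1) (ha : a ≠ 0)
    (hM : HasGrade ℓ M) (hP : kernelRows d n u w * M * (kernelRows d n u' w')ᵀ = P)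
    (p : ℕ) (δ : Fin p → ℕ) :
    AreRightMinimalIndices (kroneckerBlock a u w u' w' M) δ ↔
      ∃ ε : Fin p → ℕ, AreRightMinimalIndices P ε ∧ δ = fun i ↦ ε i + d * ℓ := by
  obtain ⟨Y, R, hs⟩ := h.exists_isSplitting hc d n ha
  obtain ⟨Y', R', hs'⟩ := h'.exists_isSplitting hc' d n one_ne_zero
  obtain ⟨τ, hτ⟩ := h.exists_hasPeaks_kronecker hℓ (left_ne_zero_of_mul_eq_one hc) d n ha
  obtain ⟨τ', hτ'⟩ := h'.exists_hasPeaks_kernelRows (left_ne_zero_of_mul_eq_one hc') d n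
  exact IsSplitBlock.areRightMinimalIndices_iff ⟨hs', hs, hP⟩ hM hτ hτ' p δ

/-- Transposing exchanges the roles of the two outer blocks. Both kernels have degree `d ℓ`, so the
shift is the same as on the right. -/
theorem areLeftMinimalIndices_kroneckerBlock (h : IsPowPair ℓ c u w)
    (h' : IsPowPair ℓ c' u' w') (hℓ : 1 ≤ ℓ) (hc : c * c = 1) (hc' : c' * c' = 1) (ha : a ≠ 0)
    (hM : HasGrade ℓ M) (hP : kernelRows d n u w * M * (kernelRows d n u' w')ᵀ = P)
    (p : ℕ) (δ : Fin p → ℕ) :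
    AreLeftMinimalIndices (kroneckerBlock a u w u' w' M) δ ↔
      ∃ η : Fin p → ℕ, AreLeftMinimalIndices P η ∧ δ = fun i ↦ η i + d * ℓ := by
  obtain ⟨Y, R, hs⟩ := h.exists_isSplitting hc d n ha
  obtain ⟨Y', R', hs'⟩ := h'.exists_isSplitting hc' d n one_ne_zero
  obtain ⟨τ, hτ⟩ := h'.exists_hasPeaks_kronecker hℓ (left_ne_zero_of_mul_eq_one hc') d n
    one_ne_zero
  obtain ⟨τ', hτ'⟩ := h.exists_hasPeaks_kernelRows (left_ne_zero_of_mul_eq_one hc) d n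
  have hsplit : IsSplitBlock _ _ _ _ _ _ _ _ M P := ⟨hs', hs, hP⟩
  rw [AreLeftMinimalIndices, kroneckerBlock, fromBlocks_transpose, transpose_transpose,
    transpose_zero]
  exact hsplit.transpose.areRightMinimalIndices_iff (fun i j ↦ hM j i) hτ hτ' p δ

end SumConditions

end MatPoly

theorem theorem4p5 {F : Type*} [Field F] (n d ℓ k : ℕ) (hℓ : 1 ≤ ℓ) (hk : k = (2 * d + 1) * ℓ)
    (P : Matrix (Fin n) (Fin n) F[X]) (hP : MatPoly.HasGrade k P)
    (M : Matrix (Fin (d + 1) × Fin n) (Fin (d + 1) × Fin n) F[X]) (hM : MatPoly.HasGrade ℓ M)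
    (A : Matrix (Fin 2) (Fin 2) F) (σ : ℤˣ)
    (h : (A = MatPoly.A₁ F ∧ MatPoly.AS ℓ M P) ∨
      (A = MatPoly.A₂ F ∧ Even ℓ ∧ MatPoly.AS ℓ M P) ∨
      (A = MatPoly.A₂ F ∧ Odd ℓ ∧ MatPoly.ASS ℓ M P) ∨
      (A = MatPoly.A₃ F ∧ MatPoly.DS ℓ M P)) :
    MatPoly.IsStrongBlockMinimalBases ℓ (MatPoly.bigL ℓ A σ M) ∧
    MatPoly.IsStrongLification ℓ k (MatPoly.bigL ℓ A σ M) P ∧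
    (∀ (p : ℕ) (δ : Fin p → ℕ), MatPoly.AreRightMinimalIndices (MatPoly.bigL ℓ A σ M) δ ↔
      ∃ ε : Fin p → ℕ, MatPoly.AreRightMinimalIndices P ε ∧ δ = fun i => ε i + d * ℓ) ∧
    (∀ (p : ℕ) (δ : Fin p → ℕ), MatPoly.AreLeftMinimalIndices (MatPoly.bigL ℓ A σ M) δ ↔
      ∃ η : Fin p → ℕ, MatPoly.AreLeftMinimalIndices P η ∧ δ = fun i => η i + d * ℓ) := by
  -- The Möbius matrix enters only through `(u, w)`: `(1, λ^ℓ)` for `A₁`, `(1, (-λ)^ℓ)` for `A₂`, so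
  -- `c` is `1` or `-1` by the parity of `ℓ`, and `(λ^ℓ, 1)` for `A₃`.
  obtain ⟨c, u, w, hc, hpair, hL, hker⟩ : ∃ (c : F) (u w : F[X]), c * c = 1 ∧
      MatPoly.IsPowPair ℓ c u w ∧
      MatPoly.bigL ℓ A σ M
        = MatPoly.kroneckerBlock ((σ : ℤ) : F) u w 1 (C (1 : F) * X ^ ℓ) M ∧
      MatPoly.kernelRows d n u w * M
        * (MatPoly.kernelRows d n 1 (C (1 : F) * X ^ ℓ)).transpose = P := by
    rcases h with ⟨rfl, h⟩ | ⟨rfl, hev, h⟩ | ⟨rfl, hodd, h⟩ | ⟨rfl, h⟩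
    · refine ⟨1, _, _, one_mul 1, .inl ⟨rfl, rfl⟩, ?_, MatPoly.AS.kernelRows_mul_mul h hℓ hk hP hM⟩
      rw [MatPoly.bigL_eq hℓ, MatPoly.kroneckerBlock]
      simp [MatPoly.A₁]
    · refine ⟨1, _, _, one_mul 1, .inl ⟨rfl, rfl⟩, ?_, MatPoly.AS.kernelRows_mul_mul h hℓ hk hP hM⟩
      rw [MatPoly.bigL_eq hℓ, MatPoly.kroneckerBlock]
      simp [MatPoly.A₂, hev.neg_pow]
    · refine ⟨-1, _, _, by simp, .inl ⟨rfl, rfl⟩, ?_, MatPoly.ASS.kernelRows_mul_mul h hℓ hk hP hM⟩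
      rw [MatPoly.bigL_eq hℓ, MatPoly.kroneckerBlock]
      simp [MatPoly.A₂, hodd.neg_pow]
    · refine ⟨1, _, _, one_mul 1, .inr ⟨rfl, rfl⟩, ?_, MatPoly.DS.kernelRows_mul_mul h hℓ hk hP hM⟩
      rw [MatPoly.bigL_eq hℓ, MatPoly.kroneckerBlock]
      simp [MatPoly.A₃]
  have hσ : ((σ : ℤ) : F) ≠ 0 := by
    rcases Int.units_eq_one_or σ with rfl | rfl <;> simp
  have hpair' : MatPoly.IsPowPair ℓ (1 : F) 1 (C (1 : F) * X ^ ℓ) := .inl ⟨rfl, rfl⟩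
  rw [hL]
  exact ⟨MatPoly.isStrongBlockMinimalBases_kroneckerBlock hpair hpair' hℓ hc (one_mul 1) hσ hM,
    MatPoly.isStrongLification_kroneckerBlock hpair hpair' hℓ hk hc (one_mul 1) hσ hP hM hker,
    MatPoly.areRightMinimalIndices_kroneckerBlock hpair hpair' hℓ hc (one_mul 1) hσ hM hker,
    MatPoly.areLeftMinimalIndices_kroneckerBlock hpair hpair' hℓ hc (one_mul 1) hσ hM hker⟩
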